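/- Let $d\ge 1$, $0<\alpha\le 2$, $\nu>0$, $0<a<1$ and $T>0$. Let $X$ be a continuous time, rate one random walk on $\mathbf Z^d$ started at $0$ with dislocation (step) distribution $\mu$; that is, $X_t=\sum_{n=1}^{N_t}\xi_n$, where $N$ is a Poisson process of rate one and $\xi_1,\xi_2,\dots$ are i.i.d. with law $\mu$, independent of $N$. Let $$\hat\mu(z)=\sum_{k\in\mathbf Z^d}e^{iz\cdot k}\mu(\{k\}),\qquad p_t(x)=\frac1{(2\pi)^d}\int_{\mathbf R^d}e^{-ix\cdot z}e^{-t\nu|z|^\alpha}\,dz,$$ so that $p_t$ is the heat kernel of $-\nu(-\Delta)^{\alpha/2}$. Define $\mathcal D$ and $\mathcal E_{k,i}$ by $$\hat\mu(z)=1-\nu|z|^\alpha+\mathcal D(z),\qquad \frac{\partial^k}{\partial z_i^k}\hat\mu(z)=-\nu\frac{\partial^k}{\partial z_i^k}|z|^\alpha+\mathcal E_{k,i}(z)\quad(k\ge1,\ 1\le i\le d).$$ Assumption 1: $\{z\in(-\pi,\pi]^d:\hat\mu(z)=1\}=\{0\}$, and $\mathcal D(z)=O(|z|^{a+\alpha})$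 as $z\to0$. Assumption 2: $\mathcal D$ is $d+3$ times continuously differentiable in a neighbourhood in $\mathbf R^d$ of every point of $(-\pi,\pi]^d\setminus\{0\}$ (with $\hat\mu$ regarded as a periodic function on $\mathbf R^d$), and $\mathcal E_{k,i}(z)=O(|z|^{\alpha+a-k})$ as $z\to0$, for all $1\le k\le d+3$ and $1\le i\le d$. (i) If Assumption 1 holds, there is a constant $C$ such that for all $\epsilon>0$, $\epsilon^\alpha\le t\le T$ and $x\in\epsilon\mathbf Z^d$, $$\left|\frac1{\epsilon^d}P(\epsilon X_{t/\epsilon^\alpha}=x)-p_t(x)\right|\le C\,\frac{\epsilon^a}{t^{(d+a)/\alpha}}.$$ (ii) If Assumptions 1 and 2 hold, there is a constant $C$ such that for all $\epsilon>0$, $\epsilon^\alpha\le t\le T$ and $x\in\epsilon\mathbf Z^d$ with $|x|\ge t^{1/\alpha}$, $$\left|\frac1{\epsilon^d}P(\epsilon X_{t/\epsilon^\alpha}=x)-p_t(x)\right|\le C\,\frac{t\,\epsilon^a}{|x|^{d+\alpha+a}}.$$ (iii) If Assumptions 1 and 2 hold and $\alpha<2$, there is a constant $C$ such that for all $\epsilon>0$,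 $\epsilon^\alpha\le t\le T$ and $x\in\epsilon\mathbf Z^d$, $$\left|\frac1{\epsilon^d}P(\epsilon X_{t/\epsilon^\alpha}=x)-p_t(x)\right|\le C\,\frac{\epsilon^a\,p_t(x)}{t^{a/\alpha}}.$$ -/

import Mathlib

open MeasureTheory ProbabilityTheory Filter Topology
open scoped NNReal

namespace LocalLimit

/-- `ℝ^d` with the Euclidean norm. -/
abbrev Space (d : ℕ) : Type := EuclideanSpace ℝ (Fin d)

/-- The inclusion of `ℤ^d` in `ℝ^d`. -/
noncomputable def toSpace {d : ℕ} (k : Fin d → ℤ) : Space d :=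
  WithLp.toLp 2 (fun i => (k i : ℝ))

/-- The lattice `ε ℤ^d`. -/
def lattice (d : ℕ) (ε : ℝ) : Set (Space d) :=
  Set.range (fun k : Fin d → ℤ => ε • toSpace k)

/-- `N` is a Poisson process of rate one. -/
structure IsPoissonProcess {Ω : Type*} [MeasurableSpace Ω] (P : Measure Ω)
    (N : ℝ≥0 → Ω → ℕ) : Prop where
  measurable : ∀ t, Measurable (N t)
  zero : ∀ ω, N 0 ω = 0
  mono : ∀ ω, Monotone (fun t => N t ω)
  right_continuous : ∀ ω t, ContinuousWithinAt (fun s => N s ω) (Set.Ici t) t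
  indep_increments : HasIndepIncrements N P
  increment_law : ∀ s t : ℝ≥0, s ≤ t →
    HasLaw (fun ω => N t ω - N s ω) (poissonMeasure (t - s)) P

/-- `X` is a continuous time, rate one random walk on `ℤ^d` started at `0`: at the jump times of
a rate one Poisson process it makes i.i.d. steps with law `μ`, independent of that process.
When `μ {0} = 0`, `μ` is the law of `X` at the first time that `X` differs from `0`. -/
def IsRateOneWalk {d : ℕ} {Ω : Type*} [MeasurableSpace Ω] (P : Measure Ω)
    (μ : Measure (Fin d → ℤ)) (X : ℝ≥0 → Ω → (Fin d → ℤ)) : Prop :=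
  ∃ (N : ℝ≥0 → Ω → ℕ) (ξ : ℕ → Ω → (Fin d → ℤ)),
    IsPoissonProcess P N ∧
    (∀ n, Measurable (ξ n)) ∧
    (∀ n, HasLaw (ξ n) μ P) ∧
    iIndepFun ξ P ∧
    IndepFun (fun ω t => N t ω) (fun ω n => ξ n ω) P ∧
    ∀ t ω, X t ω = ∑ n ∈ Finset.range (N t ω), ξ n ω

/-- The characteristic function `μ̂(z) = ∑_k e^{i z·k} μ(k)`, as a periodic function on `ℝ^d`. -/
noncomputable def charFn {d : ℕ} (μ : Measure (Fin d → ℤ)) (z : Space d) : ℂ :=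
  ∑' k : Fin d → ℤ, Complex.exp (Complex.I * (inner ℝ z (toSpace k) : ℝ)) * (μ.real {k} : ℂ)

/-- `|z|^α`, as a complex valued function. -/
noncomputable def normPow {d : ℕ} (α : ℝ) (z : Space d) : ℂ := ((‖z‖ ^ α : ℝ) : ℂ)

/-- The remainder `D` in `μ̂(z) = 1 - ν |z|^α + D(z)`. -/
noncomputable def remainder {d : ℕ} (μ : Measure (Fin d → ℤ)) (α ν : ℝ) (z : Space d) : ℂ :=
  charFn μ z - 1 + ν * normPow α z

/-- The pure partial derivative `∂^k f / ∂z_i^k` at `z`. -/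
noncomputable def partialDeriv {d : ℕ} (k : ℕ) (i : Fin d) (f : Space d → ℂ) (z : Space d) : ℂ :=
  iteratedDeriv k (fun s : ℝ => f (z + s • EuclideanSpace.single i (1 : ℝ))) 0

/-- The remainder `E_{k,i}` in `∂_i^k μ̂(z) = -ν ∂_i^k |z|^α + E_{k,i}(z)`. -/
noncomputable def derivRemainder {d : ℕ} (μ : Measure (Fin d → ℤ)) (α ν : ℝ)
    (k : ℕ) (i : Fin d) (z : Space d) : ℂ :=
  partialDeriv k i (charFn μ) z + ν * partialDeriv k i (normPow α) z

/-- The cube `(-π, π]^d`, a fundamental domain of the torus. -/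
def cube (d : ℕ) : Set (Space d) := {z | ∀ i, z i ∈ Set.Ioc (-Real.pi) Real.pi}

/-- First assumption on the walk: on `(-π, π]^d`, `μ̂ = 1` only at the origin, and
`D(z) = O(|z|^{a+α})` as `z → 0`. -/
structure Assumption1 {d : ℕ} (μ : Measure (Fin d → ℤ)) (α ν a : ℝ) : Prop where
  eq_one_iff : {z ∈ cube d | charFn μ z = 1} = {0}
  remainder_isBigO : remainder μ α ν =O[𝓝 0] fun z => ‖z‖ ^ (a + α)

/-- Second assumption on the walk: away from the origin of the torus, `D` is `d + 3` times
continuously differentiable, and `E_{k,i}(z) = O(|z|^{α+a-k})` as `z → 0`, for `1 ≤ k ≤ d + 3`.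
Differentiability at points of the boundary of the cube refers to the periodic function `μ̂`
on a full neighbourhood in `ℝ^d`. -/
structure Assumption2 {d : ℕ} (μ : Measure (Fin d → ℤ)) (α ν a : ℝ) : Prop where
  contDiffAt : ∀ z ∈ cube d, z ≠ 0 → ContDiffAt ℝ ((d + 3 : ℕ) : WithTop ℕ∞) (remainder μ α ν) z
  derivRemainder_isBigO : ∀ k : ℕ, 1 ≤ k → k ≤ d + 3 → ∀ i : Fin d,
    derivRemainder μ α ν k i =O[𝓝[≠] 0] fun z => ‖z‖ ^ (α + a - k)

/-- The heat kernel of `-ν (-Δ)^{α/2}`, that is, the transition density of the isotropic strictly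
`α`-stable process: `p_t(x) = (2π)^{-d} ∫ e^{-i x·z} e^{-tν|z|^α} dz`. The integral is real. -/
noncomputable def heatKernel {d : ℕ} (α ν t : ℝ) (x : Space d) : ℝ :=
  (((2 * Real.pi) ^ d)⁻¹ : ℝ) *
    (∫ z : Space d, Complex.exp (-Complex.I * (inner ℝ x z : ℝ)) *
      (Real.exp (-t * ν * ‖z‖ ^ α) : ℂ)).re

/-- `|ε^{-d} P(ε X_{t/ε^α} = x) - p_t(x)|`. -/
noncomputable def localError {d : ℕ} {Ω : Type*} [MeasurableSpace Ω] (P : Measure Ω)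
    (X : ℝ≥0 → Ω → (Fin d → ℤ)) (α ν ε t : ℝ) (x : Space d) : ℝ :=
  |(ε ^ d)⁻¹ * P.real {ω | ε • toSpace (X (t / ε ^ α).toNNReal ω) = x} - heatKernel α ν t x|

end LocalLimit

namespace LocalLimit

/-! ### Finite differences and derivatives of exponentials on the line -/

/-! By self-similarity of the heat kernel it suffices to compare the two laws at lattice spacing one
and time `s = t / ε ^ α ≥ 1`. There the walk has characteristic function `exp (s (μ̂ - 1))`, so its
point probabilities are Fourier integrals over the cube, while the heat kernel is the Fourier
integral of `exp (-s ν |z|^α)` over the whole space.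

Uniform bound (`Assumption1.exists_uniform_bound`). Compactness, periodicity and Assumption 1 give
`Re (1 - μ̂) ≥ c |z|^α` on the cube. Hence the two symbols differ by at most a constant times `s
|z|^(α+a) exp (-c s |z|^α)`. The same function dominates the heat symbol outside the cube, and its
integral scales like `s^(-(d+a)/α)`.

Decay (`exists_decay_bound`). Finite differences replace integration by parts, which would meet the
singularity at the origin and the boundary of the cube. Let `k_i` be a coordinate of the site `k` of
largest modulus and `h = π / |k_i|`. A shift by `h e_i` multiplies both Fourier integrals by `-1`,
without boundary terms because the walk symbol is periodic, so a difference of order `m = d + 3`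
multiplies them by `(-2)^m`. The differenced error is at most a constant times `s h^m (h +
|z|)^(α+a-m)`: for `|z|` large compared with `h` by the derivative bounds, for smaller `|z|` by the
size of the error itself. Since `α + a < 3`, this is integrable, and the integral is of order `s
h^(d+α+a)`, which is at most of order `s / |k|^(d+α+a)`.

Relative bound. For `α < 2` the two bounds are compared with the lower bound `p_1(x) ≥ c (1 +
|x|)^(-(d+α))` of `exists_le_heatKernel_one`. By Lévy–Khintchine, the stable law is a compound
Poisson law with jump density `J(y) = κ (1 + |y|)^(-(d+α))`, convolved with a law whose density `Q`
is continuous and positive at the origin. The event of exactly one jump of density `J` already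
contributes a multiple of `J * Q`, which has the required tail. All positivity statements are made
on cosine transforms, so no stable process is constructed. -/

lemma contDiffAt_deriv {f : ℝ → ℂ} {m : ℕ} {u : ℝ} (hf : ContDiffAt ℝ (m + 1 : ℕ) f u) :
    ContDiffAt ℝ m (deriv f) u :=
  hf.derivWithin (by simp)

lemma differentiableAt_iteratedDeriv {f : ℝ → ℂ} {m : ℕ} {u : ℝ}
    (hf : ContDiffAt ℝ (m + 1 : ℕ) f u) : DifferentiableAt ℝ (iteratedDeriv m f) u := by
  have := (contDiffWithinAt_univ.2 hf).differentiableWithinAt_iteratedDerivWithin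
    (m := m) (by exact_mod_cast Nat.lt_succ_self m) (by simp [uniqueDiffOn_univ])
  rwa [iteratedDerivWithin_univ, differentiableWithinAt_univ] at this

/-- An iterated forward difference is controlled by the derivative of the same order. -/
lemma norm_fwdDiff_iter_le (m : ℕ) {f : ℝ → ℂ} {h y M : ℝ} (hh : 0 ≤ h)
    (hf : ∀ u ∈ Set.Icc y (y + m * h), ContDiffAt ℝ m f u)
    (hM : ∀ u ∈ Set.Icc y (y + m * h), ‖iteratedDeriv m f u‖ ≤ M) :
    ‖(fwdDiff h)^[m] f y‖ ≤ h ^ m * M := by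
  induction m generalizing f M with
  | zero =>
    simpa using hM y (by simp)
  | succ m ih =>
    have hsub : ∀ u ∈ Set.Icc y (y + m * h), ∀ v ∈ Set.Icc u (u + h),
        v ∈ Set.Icc y (y + (m + 1 : ℕ) * h) := by
      intro u hu v hv
      push_cast
      exact ⟨hu.1.trans hv.1, by nlinarith [hu.2, hv.2]⟩
    rw [Function.iterate_succ_apply]
    have hle : (m : WithTop ℕ∞) ≤ ((m + 1 : ℕ) : WithTop ℕ∞) := by exact_mod_cast Nat.le_succ m
    have hc1 : ∀ u ∈ Set.Icc y (y + m * h), ContDiffAt ℝ m (fun v => f (v + h)) u := by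
      intro u hu
      have h1 : ContDiffAt ℝ m f (u + h) :=
        (hf (u + h) (hsub u hu _ ⟨by linarith, le_rfl⟩)).of_le hle
      exact h1.comp (f := fun v => v + h) u (by fun_prop)
    have hc2 : ∀ u ∈ Set.Icc y (y + m * h), ContDiffAt ℝ m f u := fun u hu =>
      (hf u (hsub u hu _ ⟨le_rfl, by linarith⟩)).of_le hle
    -- One difference costs a factor `h`: by the mean value inequality the `m`-th derivative of `f
    -- (· + h) - f` is at most `h * M`.
    have key := ih (f := fwdDiff h f) (M := h * M)
      (fun u hu => (hc1 u hu).sub (hc2 u hu)) (by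
        intro u hu
        have e : fwdDiff h f = (fun v => f (v + h)) - f := by ext v; simp [fwdDiff]
        rw [e, iteratedDeriv_sub (hc1 u hu) (hc2 u hu), iteratedDeriv_comp_add_const]
        have := (convex_Icc u (u + h)).norm_image_sub_le_of_norm_deriv_le
          (f := iteratedDeriv m f) (C := M) (x := u) (y := u + h)
          (fun v hv => differentiableAt_iteratedDeriv (hf v (hsub u hu v hv)))
          (fun v hv => by
            rw [← iteratedDeriv_succ]; exact hM v (hsub u hu v hv))
          ⟨le_rfl, by linarith⟩ ⟨by linarith, le_rfl⟩
        simpa [abs_of_nonneg hh, mul_comm] using this)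
    calc _ ≤ _ := key
      _ = _ := by ring

lemma eventually_differentiableAt {f : ℝ → ℂ} {m : ℕ} {u : ℝ} (hf : ContDiffAt ℝ (m + 1 : ℕ) f u) :
    ∀ᶠ v in 𝓝 u, DifferentiableAt ℝ f v := by
  filter_upwards [hf.eventually (by simp)] with v hv
  exact hv.differentiableAt (by simp)

/-- Leibniz applied to `(exp f)' = exp f * f'`. It expresses each derivative of `exp f` by lower
ones, which is the recursion behind the two strong inductions below. -/
lemma iteratedDeriv_exp_succ {f : ℝ → ℂ} {m : ℕ} {u : ℝ} (hf : ContDiffAt ℝ (m + 1 : ℕ) f u) :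
    iteratedDeriv (m + 1) (fun v => Complex.exp (f v)) u =
      ∑ i ∈ Finset.range (m + 1), (m.choose i : ℂ) *
        iteratedDeriv i (fun v => Complex.exp (f v)) u * iteratedDeriv (m - i + 1) f u := by
  have hle : (m : WithTop ℕ∞) ≤ ((m + 1 : ℕ) : WithTop ℕ∞) := by exact_mod_cast Nat.le_succ m
  have e : deriv (fun v => Complex.exp (f v)) =ᶠ[𝓝 u]
      fun v => Complex.exp (f v) * deriv f v := by
    filter_upwards [eventually_differentiableAt hf] with v hv
    exact hv.hasDerivAt.cexp.deriv
  rw [iteratedDeriv_succ', e.iteratedDeriv_eq,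
    iteratedDeriv_fun_mul (hf.of_le hle).cexp (contDiffAt_deriv hf)]
  simp_rw [iteratedDeriv_succ']

/-- Derivatives of `exp f`, when the derivatives of `f` of order `j ≥ 1` are at most `K / ρ ^ j`. -/
lemma exists_norm_iteratedDeriv_exp_le (m : ℕ) : ∃ C : ℝ, 0 ≤ C ∧
    ∀ (f : ℝ → ℂ) (u ρ K E : ℝ), 0 < ρ → 0 ≤ K → ContDiffAt ℝ m f u →
      (∀ j, 1 ≤ j → j ≤ m → ‖iteratedDeriv j f u‖ ≤ K / ρ ^ j) → ‖Complex.exp (f u)‖ ≤ E →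
      ‖iteratedDeriv m (fun v => Complex.exp (f v)) u‖ ≤ C * E * (1 + K) ^ m / ρ ^ m := by
  induction m using Nat.strong_induction_on with
  | _ n ih =>
    rcases n with _ | m
    · exact ⟨1, zero_le_one, fun f u ρ K E _ _ _ _ hE => by simpa using hE⟩
    choose! C hC0 hC using ih
    refine ⟨∑ i ∈ Finset.range (m + 1), m.choose i * C i, Finset.sum_nonneg fun i hi =>
      mul_nonneg (by positivity) (hC0 i (Finset.mem_range.1 hi)), ?_⟩
    intro f u ρ K E hρ hK hf hd hE
    have hE0 : 0 ≤ E := (norm_nonneg _).trans hE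
    rw [iteratedDeriv_exp_succ hf, Finset.sum_mul, Finset.sum_mul, Finset.sum_div]
    refine (norm_sum_le _ _).trans (Finset.sum_le_sum fun i hi => ?_)
    have hi' : i < m + 1 := Finset.mem_range.1 hi
    have h1 := hC i hi' f u ρ K E hρ hK (hf.of_le (by exact_mod_cast hi'.le))
      (fun j h1 h2 => hd j h1 (h2.trans hi'.le)) hE
    have h2 := hd (m - i + 1) (by omega) (by omega)
    rw [norm_mul, norm_mul, Complex.norm_natCast]
    have hCi := hC0 i hi'
    have hpow : ρ ^ (m + 1) = ρ ^ i * ρ ^ (m - i + 1) := by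
      rw [← pow_add]; congr 1; omega
    calc _ ≤ (m.choose i : ℝ) * (C i * E * (1 + K) ^ i / ρ ^ i) * (K / ρ ^ (m - i + 1)) := by
          gcongr
      _ = m.choose i * C i * E * ((1 + K) ^ i * K) / ρ ^ (m + 1) := by
          rw [hpow]; field_simp
      _ ≤ m.choose i * C i * E * (1 + K) ^ (m + 1) / ρ ^ (m + 1) := by
          gcongr
          calc (1 + K) ^ i * K ≤ (1 + K) ^ m * (1 + K) := by
                gcongr
                · linarith
                · omega
                · linarith
            _ = _ := by ring

/-- Derivatives of `exp f - exp g`, for two functions whose difference has small derivatives. -/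
lemma exists_norm_iteratedDeriv_exp_sub_exp_le (m : ℕ) : ∃ C : ℝ, 0 ≤ C ∧
    ∀ (f g : ℝ → ℂ) (u ρ K δ E : ℝ), 0 < ρ → 0 ≤ K → ContDiffAt ℝ m f u → ContDiffAt ℝ m g u →
      (∀ j, 1 ≤ j → j ≤ m → ‖iteratedDeriv j f u‖ ≤ K / ρ ^ j) →
      (∀ j, 1 ≤ j → j ≤ m → ‖iteratedDeriv j g u‖ ≤ K / ρ ^ j) →
      (∀ j, 1 ≤ j → j ≤ m → ‖iteratedDeriv j f u - iteratedDeriv j g u‖ ≤ δ / ρ ^ j) →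
      ‖Complex.exp (f u)‖ ≤ E → ‖Complex.exp (g u)‖ ≤ E →
      ‖Complex.exp (f u) - Complex.exp (g u)‖ ≤ E * δ →
      ‖iteratedDeriv m (fun v => Complex.exp (f v)) u -
        iteratedDeriv m (fun v => Complex.exp (g v)) u‖ ≤ C * E * δ * (1 + K) ^ m / ρ ^ m := by
  induction m using Nat.strong_induction_on with
  | _ n ih =>
    rcases n with _ | m
    · exact ⟨1, zero_le_one, fun f g u ρ K δ E _ _ _ _ _ _ _ _ _ h => by simpa using h⟩
    choose! C hC0 hC using ih
    choose B hB0 hB using exists_norm_iteratedDeriv_exp_le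
    refine ⟨∑ i ∈ Finset.range (m + 1), m.choose i * (C i + B i), Finset.sum_nonneg fun i hi =>
      mul_nonneg (by positivity) (add_nonneg (hC0 i (Finset.mem_range.1 hi)) (hB0 i)), ?_⟩
    intro f g u ρ K δ E hρ hK hf hg hdf hdg hfg hEf hEg hfg0
    have hE0 : 0 ≤ E := (norm_nonneg _).trans hEf
    have hδ : 0 ≤ δ := by
      have := (norm_nonneg _).trans (hfg 1 le_rfl (by omega))
      rwa [pow_one, le_div_iff₀ hρ, zero_mul] at this
    rw [iteratedDeriv_exp_succ hf, iteratedDeriv_exp_succ hg, ← Finset.sum_sub_distrib,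
      Finset.sum_mul, Finset.sum_mul, Finset.sum_mul, Finset.sum_div]
    refine (norm_sum_le _ _).trans (Finset.sum_le_sum fun i hi => ?_)
    have hi' : i < m + 1 := Finset.mem_range.1 hi
    have hle : (i : WithTop ℕ∞) ≤ ((m + 1 : ℕ) : WithTop ℕ∞) := by exact_mod_cast hi'.le
    have h1 := hC i hi' f g u ρ K δ E hρ hK (hf.of_le hle) (hg.of_le hle)
      (fun j h1 h2 => hdf j h1 (h2.trans hi'.le)) (fun j h1 h2 => hdg j h1 (h2.trans hi'.le))
      (fun j h1 h2 => hfg j h1 (h2.trans hi'.le)) hEf hEg hfg0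
    have h2 := hB i g u ρ K E hρ hK (hg.of_le hle) (fun j h1 h2 => hdg j h1 (h2.trans hi'.le)) hEg
    have h3 := hdf (m - i + 1) (by omega) (by omega)
    have h4 := hfg (m - i + 1) (by omega) (by omega)
    have hCi := hC0 i hi'
    have hBi := hB0 i
    generalize iteratedDeriv i (fun v => Complex.exp (f v)) u = F at *
    generalize iteratedDeriv i (fun v => Complex.exp (g v)) u = G at *
    generalize iteratedDeriv (m - i + 1) f u = f' at *
    generalize iteratedDeriv (m - i + 1) g u = g' at *
    have hpow : ρ ^ (m + 1) = ρ ^ i * ρ ^ (m - i + 1) := by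
      rw [← pow_add]; congr 1; omega
    -- In this splitting `F - G` is controlled by induction, and `G` by the bound for a single
    -- exponential.
    have e : (m.choose i : ℂ) * F * f' - m.choose i * G * g' =
        m.choose i * ((F - G) * f' + G * (f' - g')) := by ring
    rw [e, norm_mul, Complex.norm_natCast]
    calc _ ≤ (m.choose i : ℝ) * (‖F - G‖ * ‖f'‖ + ‖G‖ * ‖f' - g'‖) := by
          gcongr
          exact (norm_add_le _ _).trans (by rw [norm_mul, norm_mul])
      _ ≤ (m.choose i : ℝ) * ((C i * E * δ * (1 + K) ^ i / ρ ^ i) * (K / ρ ^ (m - i + 1)) +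
          (B i * E * (1 + K) ^ i / ρ ^ i) * (δ / ρ ^ (m - i + 1))) := by gcongr
      _ = m.choose i * (C i * K + B i) * E * δ * (1 + K) ^ i / ρ ^ (m + 1) := by
          rw [hpow]; field_simp
      _ ≤ m.choose i * ((C i + B i) * (1 + K)) * E * δ * (1 + K) ^ m / ρ ^ (m + 1) := by
          gcongr
          · nlinarith
          · linarith
          · omega
      _ = _ := by ring

/-! ### Fourier inversion on the cube, and the characteristic function of the walk -/

section Fourier

variable {d : ℕ}

lemma inner_toSpace (z : Space d) (k : Fin d → ℤ) :
    inner ℝ z (toSpace k) = ∑ i, z i * k i := by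
  simp [toSpace, PiLp.inner_apply, mul_comm]

lemma norm_exp_I_mul (x : ℝ) : ‖Complex.exp (Complex.I * x)‖ = 1 := by
  rw [mul_comm, Complex.norm_exp_ofReal_mul_I]

lemma norm_exp_neg_I_mul (x : ℝ) : ‖Complex.exp (-Complex.I * x)‖ = 1 := by
  have := norm_exp_I_mul (-x)
  simpa using this

lemma cube_preimage : (WithLp.toLp 2 : (Fin d → ℝ) → Space d) ⁻¹' cube d =
    Set.pi Set.univ (fun _ => Set.Ioc (-Real.pi) Real.pi) := by
  ext z; simp [cube]

lemma measurableSet_cube : MeasurableSet (cube d) := by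
  have : cube d = ⋂ i, (fun z : Space d => z i) ⁻¹' Set.Ioc (-Real.pi) Real.pi := by
    ext z; simp [cube]
  rw [this]
  exact MeasurableSet.iInter fun i =>
    (by fun_prop : Measurable fun z : Space d => z i) measurableSet_Ioc

lemma setIntegral_cube_prod (f : Fin d → ℝ → ℂ) :
    ∫ z in cube d, ∏ i, f i (z i) = ∏ i, ∫ x in Set.Ioc (-Real.pi) Real.pi, f i x := by
  have e := (PiLp.volume_preserving_toLp (Fin d)).setIntegral_preimage_emb
    (MeasurableEquiv.toLp 2 (Fin d → ℝ)).measurableEmbedding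
    (fun z : Space d => ∏ i, f i (z i)) (cube d)
  rw [← e, cube_preimage, volume_pi, Measure.restrict_pi_pi]
  exact integral_fintype_prod_eq_prod f

lemma volume_cube_lt_top : volume (cube d) < ⊤ := by
  have e := (PiLp.volume_preserving_toLp (Fin d)).measure_preimage
    (measurableSet_cube (d := d)).nullMeasurableSet
  rw [← e, cube_preimage, volume_pi, Measure.pi_pi]
  simp only [Real.volume_Ioc]
  exact ENNReal.prod_lt_top fun _ _ => ENNReal.ofReal_lt_top

lemma integral_exp_int (n : ℤ) :
    ∫ x in Set.Ioc (-Real.pi) Real.pi, Complex.exp (Complex.I * ((x * n : ℝ) : ℂ)) =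
      if n = 0 then 2 * (Real.pi : ℂ) else 0 := by
  rw [← intervalIntegral.integral_of_le (by linarith [Real.pi_pos])]
  split_ifs with h
  · simp [h]; ring
  · have hn : Complex.I * (n : ℂ) ≠ 0 := by simp [h]
    have e : ∀ x : ℝ, Complex.exp (Complex.I * ((x * n : ℝ) : ℂ)) =
        Complex.exp (Complex.I * n * x) := fun x => by push_cast; ring_nf
    simp_rw [e]
    rw [integral_exp_mul_complex hn, div_eq_zero_iff]
    left
    have : Complex.I * n * (Real.pi : ℂ) =
        Complex.I * n * ((-Real.pi : ℝ) : ℂ) + n * (2 * Real.pi * Complex.I) := by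
      push_cast; ring
    rw [this, Complex.exp_add, Complex.exp_int_mul_two_pi_mul_I, mul_one, sub_self]

lemma integral_cube_exp (n : Fin d → ℤ) :
    ∫ z in cube d, Complex.exp (Complex.I * (inner ℝ z (toSpace n) : ℝ)) =
      if n = 0 then (2 * (Real.pi : ℂ)) ^ d else 0 := by
  have e : ∀ z : Space d, Complex.exp (Complex.I * (inner ℝ z (toSpace n) : ℝ)) =
      ∏ i, Complex.exp (Complex.I * ((z i * n i : ℝ) : ℂ)) := by
    intro z
    rw [inner_toSpace, ← Complex.exp_sum, Complex.ofReal_sum, Finset.mul_sum]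
  simp_rw [e]
  rw [setIntegral_cube_prod (fun i x => Complex.exp (Complex.I * ((x * n i : ℝ) : ℂ)))]
  simp_rw [integral_exp_int]
  split_ifs with h
  · simp [h]
  · obtain ⟨i, hi⟩ := Function.ne_iff.1 h
    exact Finset.prod_eq_zero (Finset.mem_univ i) (by simpa using hi)

lemma toSpace_sub (k l : Fin d → ℤ) : toSpace (k - l) = toSpace k - toSpace l := by
  ext i; simp [toSpace]

/-- The Fourier coefficients of an absolutely convergent Fourier series. -/
lemma integral_cube_fourierSeries (c : (Fin d → ℤ) → ℂ) (hc : Summable fun l => ‖c l‖)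
    (k : Fin d → ℤ) :
    ∫ z in cube d, Complex.exp (-Complex.I * (inner ℝ (toSpace k) z : ℝ)) *
      ∑' l, Complex.exp (Complex.I * (inner ℝ z (toSpace l) : ℝ)) * c l =
      (2 * (Real.pi : ℂ)) ^ d * c k := by
  have : IsFiniteMeasure (volume.restrict (cube d)) := ⟨by simpa using volume_cube_lt_top⟩
  have e : ∀ z : Space d, Complex.exp (-Complex.I * (inner ℝ (toSpace k) z : ℝ)) *
      ∑' l, Complex.exp (Complex.I * (inner ℝ z (toSpace l) : ℝ)) * c l =
      ∑' l, Complex.exp (Complex.I * (inner ℝ z (toSpace (l - k)) : ℝ)) * c l := by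
    intro z
    rw [← tsum_mul_left]
    congr with l
    rw [← mul_assoc, ← Complex.exp_add, toSpace_sub, inner_sub_right, real_inner_comm z]
    push_cast; ring_nf
  have hn : ∀ l (z : Space d),
      ‖Complex.exp (Complex.I * (inner ℝ z (toSpace (l - k)) : ℝ)) * c l‖ = ‖c l‖ := by
    intro l z
    rw [norm_mul, norm_exp_I_mul, one_mul]
  simp_rw [e]
  rw [← integral_tsum_of_summable_integral_norm]
  · rw [tsum_eq_single k]
    · rw [integral_mul_const, integral_cube_exp]; simp
    · intro l hl
      rw [integral_mul_const, integral_cube_exp, if_neg (sub_ne_zero.2 hl), zero_mul]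
  · intro l
    refine Integrable.mono' (integrable_const ‖c l‖) ?_ (ae_of_all _ fun z => (hn l z).le)
    exact Continuous.aestronglyMeasurable (by fun_prop)
  · simp_rw [hn, integral_const, smul_eq_mul]
    exact hc.mul_left _

end Fourier

/-! ### The law of the walk at a fixed time. -/

section Walk

variable {d : ℕ} {Ω : Type*} [MeasurableSpace Ω] {P : Measure Ω}

lemma summable_measureReal_singleton (μ : Measure (Fin d → ℤ)) [IsFiniteMeasure μ] :
    Summable fun k => μ.real {k} := by
  refine ENNReal.summable_toReal ?_
  rw [← measure_iUnion (fun i j h => by simpa using h) fun k => measurableSet_singleton k]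
  exact measure_ne_top _ _

lemma charFn_eq_integral (μ : Measure (Fin d → ℤ)) [IsFiniteMeasure μ] (z : Space d) :
    charFn μ z = ∫ k, Complex.exp (Complex.I * (inner ℝ z (toSpace k) : ℝ)) ∂μ := by
  rw [integral_countable]
  · simp [charFn, mul_comm]
  · exact Integrable.mono' (integrable_const (1 : ℝ)) .of_discrete
      (ae_of_all _ fun k => (norm_exp_I_mul _).le)

lemma exp_inner_sum (z : Space d) (n : ℕ) (y : ℕ → Fin d → ℤ) :
    Complex.exp (Complex.I * (inner ℝ z (toSpace (∑ i ∈ Finset.range n, y i)) : ℝ)) =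
      ∏ i : Fin n, Complex.exp (Complex.I * (inner ℝ z (toSpace (y i)) : ℝ)) := by
  rw [Fin.prod_univ_eq_prod_range (fun i => Complex.exp (Complex.I * (inner ℝ z (toSpace (y i)) : ℝ))),
    ← Complex.exp_sum, ← Finset.mul_sum]
  congr 2
  rw [← Complex.ofReal_sum]
  congr 1
  simp_rw [inner_toSpace]
  rw [Finset.sum_comm]
  simp [Finset.mul_sum]

lemma IsPoissonProcess.hasLaw {N : ℝ≥0 → Ω → ℕ} (hN : IsPoissonProcess P N) (s : ℝ≥0) :
    HasLaw (N s) (poissonMeasure s) P := by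
  simpa [hN.zero] using hN.increment_law 0 s zero_le

/-- The characteristic function of the walk at time `s` is `exp (s (μ̂ - 1))`. -/
lemma charFn_map_walk [IsProbabilityMeasure P] {μ : Measure (Fin d → ℤ)} [IsProbabilityMeasure μ]
    {X : ℝ≥0 → Ω → (Fin d → ℤ)} (hX : IsRateOneWalk P μ X) (s : ℝ≥0) (z : Space d) :
    Measurable (X s) ∧ charFn (P.map (X s)) z = Complex.exp (s * (charFn μ z - 1)) := by
  obtain ⟨N, ξ, hN, hξm, hξl, hξi, hind, hXe⟩ := hX
  have hmS : Measurable (fun p : ℕ × (ℕ → Fin d → ℤ) => ∑ i ∈ Finset.range p.1, p.2 i) :=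
    measurable_from_prod_countable_right fun n => by
      simp only
      exact Finset.measurable_sum _ fun i _ => measurable_pi_apply i
  have hξm' : Measurable (fun ω n => ξ n ω) := measurable_pi_lambda _ hξm
  have hXs : X s = (fun p : ℕ × (ℕ → Fin d → ℤ) => ∑ i ∈ Finset.range p.1, p.2 i) ∘
      fun ω => (N s ω, fun n => ξ n ω) := by
    ext1 ω; exact hXe s ω
  have hmeas : Measurable (X s) := by
    rw [hXs]; exact hmS.comp ((hN.measurable s).prodMk hξm')
  refine ⟨hmeas, ?_⟩
  have : IsProbabilityMeasure (P.map (X s)) := Measure.isProbabilityMeasure_map hmeas.aemeasurable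
  have hindN : IndepFun (N s) (fun ω n => ξ n ω) P :=
    hind.comp (φ := fun f : ℝ≥0 → ℕ => f s) (ψ := id) (measurable_pi_apply s) measurable_id
  let φ : (Fin d → ℤ) → ℂ := fun k => Complex.exp (Complex.I * (inner ℝ z (toSpace k) : ℝ))
  have hφm : Measurable φ := .of_discrete
  have hφ1 : ∀ k, ‖φ k‖ = 1 := fun k => norm_exp_I_mul _
  have hprod := (indepFun_iff_map_prod_eq_prod_map_map (hN.measurable s).aemeasurable
    hξm'.aemeasurable).1 hindN
  have : IsProbabilityMeasure (P.map (N s)) :=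
    Measure.isProbabilityMeasure_map (hN.measurable s).aemeasurable
  have : IsProbabilityMeasure (P.map fun ω n => ξ n ω) :=
    Measure.isProbabilityMeasure_map hξm'.aemeasurable
  have hpow : ∀ n : ℕ, ∫ y, φ (∑ i ∈ Finset.range n, y i) ∂(P.map fun ω n => ξ n ω) =
      charFn μ z ^ n := by
    intro n
    rw [integral_map hξm'.aemeasurable (f := fun y => φ (∑ i ∈ Finset.range n, y i)) (hφm.comp
      (Finset.measurable_sum _ fun i _ => measurable_pi_apply i)).aestronglyMeasurable]
    have e : ∀ ω, φ (∑ i ∈ Finset.range n, ξ i ω) = ∏ i : Fin n, φ (ξ i ω) := fun ω =>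
      exp_inner_sum z n (fun i => ξ i ω)
    simp_rw [e]
    rw [(hξi.precomp (g := fun i : Fin n => (i : ℕ)) Fin.val_injective).integral_fun_prod_comp
      (f := fun _ => φ) (fun i => (hξm i).aemeasurable) (fun i => hφm.aestronglyMeasurable)]
    have e2 : ∀ i : ℕ, ∫ ω, φ (ξ i ω) ∂P = charFn μ z := by
      intro i
      rw [charFn_eq_integral, ← (hξl i).map_eq, integral_map (hξm i).aemeasurable
        hφm.aestronglyMeasurable]
    simp [e2]
  rw [charFn_eq_integral]
  change ∫ k, φ k ∂_ = _
  -- By independence the steps are integrated out first, for a fixed number of jumps. The Poisson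
  -- average of `μ̂ ^ n` then sums to an exponential.
  rw [hXs, ← Measure.map_map hmS ((hN.measurable s).prodMk hξm'), hprod,
    integral_map hmS.aemeasurable hφm.aestronglyMeasurable, integral_prod]
  · simp_rw [hpow]
    rw [(hN.hasLaw s).map_eq, integral_poissonMeasure]
    have e : ∀ n : ℕ, (Real.exp (-s) * s ^ n / n.factorial) • charFn μ z ^ n =
        Complex.exp (-s) * ((s * charFn μ z) ^ n / n.factorial) := by
      intro n
      rw [Complex.real_smul]
      push_cast
      ring
    simp_rw [e]
    rw [tsum_mul_left, (NormedSpace.expSeries_div_hasSum_exp ((s : ℂ) * charFn μ z)).tsum_eq,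
      ← Complex.exp_eq_exp_ℂ, ← Complex.exp_add]
    ring_nf
  · exact Integrable.mono' (integrable_const (1 : ℝ))
      (hφm.comp hmS).aestronglyMeasurable (ae_of_all _ fun p => (hφ1 _).le)

end Walk

/-! ### Partial derivatives -/

section PartialDeriv

variable {d : ℕ}

/-- Transfers joint smoothness to the one-variable derivatives along coordinate lines; in particular
it makes them continuous in the base point, as the compactness arguments require. -/
lemma partialDeriv_eq_iteratedFDeriv {k : ℕ} {i : Fin d} {f : Space d → ℂ} {z : Space d}
    (hf : ContDiffAt ℝ k f z) :
    partialDeriv k i f z = iteratedFDeriv ℝ k f z fun _ => EuclideanSpace.single i (1 : ℝ) := by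
  let e : Space d := EuclideanSpace.single i (1 : ℝ)
  let g : ℝ →L[ℝ] Space d := ContinuousLinearMap.toSpanSingleton ℝ e
  have hf0 : ContDiffAt ℝ k (fun w => f (z + w)) 0 := by
    have : ContDiffAt ℝ k f (z + 0) := by simpa using hf
    exact this.comp (f := fun w => z + w) 0 (by fun_prop)
  obtain ⟨u, hu, hcd⟩ := hf0.contDiffOn le_rfl (by simp)
  have hU : IsOpen (interior u) := isOpen_interior
  have h0 : g 0 ∈ interior u := by simpa using mem_interior_iff_mem_nhds.2 hu
  have hV : IsOpen (g ⁻¹' interior u) := hU.preimage g.continuous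
  have key := g.iteratedFDerivWithin_comp_right (hcd.mono interior_subset) hU.uniqueDiffOn
    hV.uniqueDiffOn (x := 0) h0 (i := k) le_rfl
  rw [iteratedFDerivWithin_of_isOpen k hV h0, iteratedFDerivWithin_of_isOpen k hU h0,
    iteratedFDeriv_comp_add_left] at key
  rw [partialDeriv, iteratedDeriv_eq_iteratedFDeriv]
  change iteratedFDeriv ℝ k ((fun w => f (z + w)) ∘ g) 0 _ = _
  rw [key]
  simp [g, e]

lemma continuousAt_partialDeriv {k : ℕ} {i : Fin d} {f : Space d → ℂ} {z : Space d}
    (hf : ContDiffAt ℝ k f z) : ContinuousAt (partialDeriv k i f) z := by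
  have h1 : ContinuousAt
      (fun w => iteratedFDeriv ℝ k f w fun _ => EuclideanSpace.single i (1 : ℝ)) z :=
    (continuous_eval_const _).continuousAt.comp (hf.continuousAt_iteratedFDeriv le_rfl)
  refine h1.congr ?_
  filter_upwards [hf.eventually (by simp)] with w hw
  rw [partialDeriv_eq_iteratedFDeriv hw]

lemma iteratedDeriv_comp_line (k : ℕ) (i : Fin d) (f : Space d → ℂ) (z : Space d) (u : ℝ) :
    iteratedDeriv k (fun s : ℝ => f (z + s • EuclideanSpace.single i (1 : ℝ))) u =
      partialDeriv k i f (z + u • EuclideanSpace.single i (1 : ℝ)) := by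
  have := congrFun (iteratedDeriv_comp_const_add k
    (fun s : ℝ => f (z + s • EuclideanSpace.single i (1 : ℝ))) u) 0
  simp only [add_zero] at this
  rw [← this, partialDeriv]
  simp_rw [add_smul, add_assoc]

lemma contDiffAt_comp_line {m : ℕ} {i : Fin d} {f : Space d → ℂ} {z : Space d} {u : ℝ}
    (hf : ContDiffAt ℝ m f (z + u • EuclideanSpace.single i (1 : ℝ))) :
    ContDiffAt ℝ m (fun s : ℝ => f (z + s • EuclideanSpace.single i (1 : ℝ))) u :=
  hf.comp (f := fun s : ℝ => z + s • (EuclideanSpace.single i (1 : ℝ) : Space d)) u (by fun_prop)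

lemma iteratedDeriv_comp_mul (k : ℕ) (f : ℝ → ℂ) (c : ℝ) :
    iteratedDeriv k (fun u => f (c * u)) = fun u => c ^ k • iteratedDeriv k f (c * u) := by
  induction k with
  | zero => simp
  | succ k ih =>
    rw [iteratedDeriv_succ, ih, iteratedDeriv_succ]
    ext u
    have := deriv_const_smul_field (x := u) (c ^ k) (fun u => iteratedDeriv k f (c * u))
    change deriv (fun u => c ^ k • iteratedDeriv k f (c * u)) u = _ at this
    rw [this, deriv_comp_mul_left, smul_smul, pow_succ]

lemma contDiffAt_normPow (α : ℝ) {z : Space d} (hz : z ≠ 0) (n : WithTop ℕ∞) :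
    ContDiffAt ℝ n (normPow α) z :=
  Complex.ofRealCLM.contDiff.contDiffAt.comp z
    ((contDiffAt_norm ℝ hz).rpow_const_of_ne (norm_ne_zero_iff.2 hz))

/-- Each derivative of order `k` of a function homogeneous of degree `α` is homogeneous of degree `α
- k`. -/
lemma partialDeriv_normPow_smul (α : ℝ) (k : ℕ) (i : Fin d) (z : Space d) {r : ℝ} (hr : 0 < r) :
    partialDeriv k i (normPow α) (r • z) = ((r ^ (α - k) : ℝ) : ℂ) * partialDeriv k i (normPow α) z := by
  have e : (fun s : ℝ => normPow α (r • z + s • EuclideanSpace.single i (1 : ℝ))) =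
      fun s : ℝ => ((r ^ α : ℝ) : ℂ) *
        (fun s : ℝ => normPow α (z + s • EuclideanSpace.single i (1 : ℝ))) (r⁻¹ * s) := by
    ext s
    have : r • z + s • EuclideanSpace.single i (1 : ℝ) =
        r • (z + (r⁻¹ * s) • EuclideanSpace.single i (1 : ℝ)) := by
      rw [smul_add, smul_smul, ← mul_assoc, mul_inv_cancel₀ hr.ne', one_mul]
    rw [this]
    simp only [normPow]
    rw [norm_smul, Real.norm_of_nonneg hr.le, Real.mul_rpow hr.le (norm_nonneg _)]
    push_cast; rfl
  rw [partialDeriv, e, iteratedDeriv_const_mul_field,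
    iteratedDeriv_comp_mul k (fun s : ℝ => normPow α (z + s • EuclideanSpace.single i (1 : ℝ)))]
  simp only [mul_zero, Complex.real_smul]
  rw [← partialDeriv, ← mul_assoc]
  congr 1
  rw [← Complex.ofReal_mul, Real.rpow_sub hr, Real.rpow_natCast, inv_pow]
  rfl

/-- By homogeneity only the unit sphere matters, and it is compact. -/
lemma exists_norm_partialDeriv_normPow_le (α : ℝ) (k : ℕ) (i : Fin d) :
    ∃ C : ℝ, ∀ z : Space d, z ≠ 0 →
      ‖partialDeriv k i (normPow α) z‖ ≤ C * ‖z‖ ^ (α - k) := by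
  obtain ⟨C, hC⟩ := (isCompact_sphere (0 : Space d) 1).exists_bound_of_continuousOn
    (f := partialDeriv k i (normPow α)) (fun z hz => (continuousAt_partialDeriv
      (contDiffAt_normPow α (by rintro rfl; simp at hz) k)).continuousWithinAt)
  refine ⟨C, fun z hz => ?_⟩
  have hz' : 0 < ‖z‖ := norm_pos_iff.2 hz
  have h1 := hC (‖z‖⁻¹ • z) (by simp [norm_smul, hz'.ne'])
  have h2 := partialDeriv_normPow_smul α k i (‖z‖⁻¹ • z) hz'
  rw [smul_smul, mul_inv_cancel₀ hz'.ne', one_smul] at h2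
  rw [h2, norm_mul, Complex.norm_real, Real.norm_of_nonneg (by positivity), mul_comm]
  gcongr

end PartialDeriv

/-! ### Characteristic functions -/

section CharFn

variable {d : ℕ} {μ : Measure (Fin d → ℤ)} {α ν a : ℝ}

lemma continuous_charFn [IsProbabilityMeasure μ] : Continuous (charFn μ) := by
  refine continuous_tsum (fun k => by fun_prop) (summable_measureReal_singleton μ) fun k z => ?_
  rw [norm_mul, norm_exp_I_mul, one_mul, Complex.norm_real, Real.norm_of_nonneg measureReal_nonneg]

lemma norm_charFn_le_one [IsProbabilityMeasure μ] (z : Space d) : ‖charFn μ z‖ ≤ 1 := by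
  rw [charFn_eq_integral]
  refine (norm_integral_le_integral_norm _).trans ?_
  simp

lemma charFn_add_period (z : Space d) (n : Fin d → ℤ) :
    charFn μ (z + (2 * Real.pi) • toSpace n) = charFn μ z := by
  unfold charFn
  congr with k
  congr 1
  rw [inner_add_left, inner_smul_left, inner_toSpace (toSpace n)]
  have : ∑ i, (toSpace n : Space d) i * (k i : ℝ) = ((∑ i, n i * k i : ℤ) : ℝ) := by
    simp [toSpace]
  rw [this]
  simp only [conj_trivial]
  rw [← Complex.exp_periodic.int_mul (∑ i, n i * k i) (Complex.I * (inner ℝ z (toSpace k) : ℝ))]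
  congr 1
  push_cast
  ring

/-- The closed cube `[-π - 1/2, π + 1/2]^d`, which contains no point of `2π ℤ^d` but `0`. -/
def bigCube (d : ℕ) : Set (Space d) := {z | ∀ i, |z i| ≤ Real.pi + 1 / 2}

lemma isCompact_bigCube : IsCompact (bigCube d) := by
  have h : IsCompact (Set.univ.pi fun _ : Fin d =>
      Set.Icc (-(Real.pi + 1 / 2)) (Real.pi + 1 / 2)) := isCompact_univ_pi fun _ => isCompact_Icc
  have e : bigCube d = (WithLp.toLp 2) '' (Set.univ.pi fun _ : Fin d =>
      Set.Icc (-(Real.pi + 1 / 2)) (Real.pi + 1 / 2)) := by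
    ext z
    constructor
    · intro hz
      exact ⟨WithLp.ofLp z, fun i _ => abs_le.1 (hz i), rfl⟩
    · rintro ⟨w, hw, rfl⟩ i
      exact abs_le.2 (hw i trivial)
  rw [e]
  exact h.image (PiLp.continuous_toLp 2 _)

lemma cube_subset_bigCube : cube d ⊆ bigCube d := fun z hz i =>
  abs_le.2 ⟨by linarith [(hz i).1], by linarith [(hz i).2]⟩

/-- Lets periodicity carry the assumptions, which concern the half-open cube, over to a compact cube
with room for small shifts. -/
lemma exists_cube_translate {z : Space d} (hz : z ∈ bigCube d) (hz0 : z ≠ 0) :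
    ∃ w ∈ cube d, w ≠ 0 ∧ ∃ n : Fin d → ℤ, z = w + (2 * Real.pi) • toSpace n := by
  have hp : (0 : ℝ) < 2 * Real.pi := by positivity
  let n : Fin d → ℤ := fun i => toIocDiv hp (-Real.pi) (z i)
  have hw : ∀ i, (z - (2 * Real.pi) • toSpace n) i = toIocMod hp (-Real.pi) (z i) := by
    intro i
    rw [← self_sub_toIocDiv_zsmul hp]
    simp [toSpace, n, mul_comm]
  refine ⟨z - (2 * Real.pi) • toSpace n, fun i => ?_, ?_, n, by simp⟩
  · rw [hw]
    have := toIocMod_mem_Ioc hp (-Real.pi) (z i)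
    rwa [show -Real.pi + 2 * Real.pi = Real.pi by ring] at this
  · intro h
    apply hz0
    have hzn : ∀ i, z i = 2 * Real.pi * n i := by
      intro i
      have := congrArg (fun v : Space d => v i) h
      simp [toSpace] at this
      linarith
    ext i
    have h1 := hz i
    rw [hzn, abs_mul, abs_of_pos hp] at h1
    -- `π + 1/2 < 2π`, so a period in the large cube vanishes.
    have h3 : |(n i : ℝ)| < 1 := by
      by_contra! h2
      nlinarith [Real.pi_gt_three]
    have h4 : n i = 0 := by
      rw [← Int.abs_lt_one_iff]; exact_mod_cast h3
    rw [hzn, h4]; simp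

/-- A bound near the origin extends to the large cube. -/
lemma exists_bound_on_bigCube {f : Space d → ℂ} {β : ℝ}
    (hf : ∀ z ∈ bigCube d, z ≠ 0 → ContinuousAt f z)
    (hO : f =O[𝓝[≠] 0] fun z => ‖z‖ ^ β) :
    ∃ C : ℝ, ∀ z ∈ bigCube d, z ≠ 0 → ‖f z‖ ≤ C * ‖z‖ ^ β := by
  obtain ⟨c, hc⟩ := hO.bound
  rw [eventually_nhdsWithin_iff, Metric.eventually_nhds_iff] at hc
  obtain ⟨r, hr, hc⟩ := hc
  have hK : IsCompact (bigCube d ∩ {z | r ≤ ‖z‖}) :=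
    isCompact_bigCube.inter_right (isClosed_le continuous_const continuous_norm)
  have hK0 : ∀ z ∈ bigCube d ∩ {z | r ≤ ‖z‖}, z ≠ 0 := by
    rintro z ⟨-, hz⟩ rfl
    simp at hz; linarith
  obtain ⟨C, hC⟩ := hK.exists_bound_of_continuousOn
    (f := fun z => f z * ((‖z‖ ^ (-β) : ℝ) : ℂ)) (fun z hz => by
      refine ((hf z hz.1 (hK0 z hz)).mul ?_).continuousWithinAt
      exact Complex.continuous_ofReal.continuousAt.comp
        (continuousAt_id.norm.rpow_const (Or.inl (norm_ne_zero_iff.2 (hK0 z hz)))))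
  refine ⟨max c C, fun z hz hz0 => ?_⟩
  have hz' : 0 < ‖z‖ := norm_pos_iff.2 hz0
  rcases lt_or_ge ‖z‖ r with h | h
  · have := hc (by simpa using h) hz0
    rw [Real.norm_of_nonneg (by positivity)] at this
    refine this.trans ?_
    gcongr
    exact le_max_left _ _
  · have := hC z ⟨hz, h⟩
    rw [norm_mul, Complex.norm_real, Real.norm_of_nonneg (by positivity), Real.rpow_neg hz'.le,
      ← div_eq_mul_inv, div_le_iff₀ (by positivity)] at this
    refine this.trans ?_
    gcongr
    exact le_max_right _ _

lemma charFn_re_le_one [IsProbabilityMeasure μ] (z : Space d) : (charFn μ z).re ≤ 1 :=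
  (Complex.re_le_norm _).trans (norm_charFn_le_one z)

/-- Since `|μ̂| ≤ 1`, real part `1` forces `μ̂ = 1`, which Assumption 1 excludes off the origin, up
to periods. -/
lemma Assumption1.charFn_re_lt_one [IsProbabilityMeasure μ] (h : Assumption1 μ α ν a) {z : Space d} (hz : z ∈ bigCube d)
    (hz0 : z ≠ 0) : (charFn μ z).re < 1 := by
  refine lt_of_le_of_ne (charFn_re_le_one z) fun he => hz0 ?_
  have h1 := norm_charFn_le_one (μ := μ) z
  have h2 : (charFn μ z).im = 0 := by
    have h3 := Complex.sq_norm (charFn μ z)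
    rw [Complex.normSq_apply, he] at h3
    nlinarith [norm_nonneg (charFn μ z)]
  have h3 : charFn μ z = 1 := Complex.ext (by simpa using he) (by simpa using h2)
  obtain ⟨w, hw, hw0, n, rfl⟩ := exists_cube_translate hz hz0
  rw [charFn_add_period] at h3
  have : w ∈ ({0} : Set (Space d)) := by rw [← h.eq_one_iff]; exact ⟨hw, h3⟩
  exact absurd this hw0

lemma Assumption1.remainder_zero (h : Assumption1 μ α ν a) (hα : 0 < α) :
    remainder μ α ν (0 : Space d) = 0 := by
  have : (0 : Space d) ∈ {z ∈ cube d | charFn μ z = 1} := by rw [h.eq_one_iff]; rfl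
  simp [remainder, this.2, normPow, Real.zero_rpow hα.ne']

lemma continuous_normPow (hα : 0 < α) : Continuous (normPow α : Space d → ℂ) :=
  Complex.continuous_ofReal.comp (continuous_norm.rpow_const fun _ => Or.inr hα.le)

lemma Assumption1.exists_remainder_le [IsProbabilityMeasure μ] (h : Assumption1 μ α ν a) (hα : 0 < α) :
    ∃ C : ℝ, 0 < C ∧ ∀ z ∈ bigCube d, ‖remainder μ α ν z‖ ≤ C * ‖z‖ ^ (α + a) := by
  have hcont : Continuous (remainder μ α ν) :=
    (continuous_charFn.sub continuous_const).add (continuous_const.mul (continuous_normPow hα))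
  obtain ⟨C, hC⟩ := exists_bound_on_bigCube (β := α + a)
    (fun z _ _ => hcont.continuousAt (x := z))
    (by rw [add_comm α a]; exact h.remainder_isBigO.mono nhdsWithin_le_nhds)
  refine ⟨max C 1, by positivity, fun z hz => ?_⟩
  rcases eq_or_ne z 0 with rfl | hz0
  · rw [h.remainder_zero hα]; simp; positivity
  · refine (hC z hz hz0).trans ?_
    gcongr
    exact le_max_left _ _

/-- `Re (1 - μ̂)` is at least of order `|z|^α` on the large cube. -/
lemma Assumption1.exists_le_one_sub_re [IsProbabilityMeasure μ] (h : Assumption1 μ α ν a) (hα : 0 < α) (ha : 0 < a)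
    (hν : 0 < ν) :
    ∃ c : ℝ, 0 < c ∧ c ≤ ν ∧ ∀ z ∈ bigCube d, c * ‖z‖ ^ α ≤ 1 - (charFn μ z).re := by
  have hne : ∀ z ∈ bigCube d, z ≠ 0 → 0 < 1 - (charFn μ z).re := fun z hz hz0 => by
    linarith [h.charFn_re_lt_one hz hz0]
  obtain ⟨B, hB0, hB⟩ := h.exists_remainder_le hα
  -- The lower bound is read as an upper bound of the reciprocal, to which `exists_bound_on_bigCube`
  -- applies.
  have hO : (fun z : Space d => (((1 - (charFn μ z).re)⁻¹ : ℝ) : ℂ)) =O[𝓝[≠] 0]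
      fun z => ‖z‖ ^ (-α) := by
    have h0 : Tendsto (fun z : Space d => B * ‖z‖ ^ a) (𝓝[≠] 0) (𝓝 0) := by
      have : Continuous fun z : Space d => B * ‖z‖ ^ a :=
        continuous_const.mul (continuous_norm.rpow_const fun _ => Or.inr ha.le)
      have := this.tendsto 0
      simp only [norm_zero, Real.zero_rpow ha.ne', mul_zero] at this
      exact this.mono_left nhdsWithin_le_nhds
    have hnear : ∀ᶠ z : Space d in 𝓝[≠] 0, z ∈ bigCube d := by
      refine nhdsWithin_le_nhds ?_
      filter_upwards [Metric.ball_mem_nhds (0 : Space d) one_pos] with z hz i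
      have h1 := PiLp.norm_apply_le z i
      rw [Real.norm_eq_abs] at h1
      have h2 : ‖z‖ < 1 := by simpa using hz
      linarith [Real.pi_gt_three]
    refine Asymptotics.IsBigO.of_bound (2 / ν) ?_
    filter_upwards [hnear, h0.eventually (gt_mem_nhds (half_pos hν)), self_mem_nhdsWithin]
      with z hz hz1 hz0
    have hz' : 0 < ‖z‖ := norm_pos_iff.2 hz0
    have h1 : (remainder μ α ν z).re = (charFn μ z).re - 1 + ν * ‖z‖ ^ α := by
      simp [remainder, normPow, ← Complex.ofReal_mul]
    have h2 : (remainder μ α ν z).re ≤ B * ‖z‖ ^ a * ‖z‖ ^ α := by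
      refine (Complex.re_le_norm _).trans ((hB z hz).trans_eq ?_)
      rw [Real.rpow_add hz']; ring
    have hp : 0 < ‖z‖ ^ α := by positivity
    have h3 : ν / 2 * ‖z‖ ^ α ≤ 1 - (charFn μ z).re := by nlinarith
    rw [Complex.norm_real, norm_inv, Real.norm_of_nonneg (hne z hz hz0).le,
      Real.norm_of_nonneg (by positivity), Real.rpow_neg hz'.le, ← one_div,
      div_le_iff₀ (hne z hz hz0)]
    calc (1 : ℝ) = 2 / ν * (‖z‖ ^ α)⁻¹ * (ν / 2 * ‖z‖ ^ α) := by field_simp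
      _ ≤ _ := by gcongr
  obtain ⟨C, hC⟩ := exists_bound_on_bigCube (fun z hz hz0 => by
    refine Complex.continuous_ofReal.continuousAt.comp (ContinuousAt.inv₀ ?_ (hne z hz hz0).ne')
    exact (continuous_const.sub
      (Complex.continuous_re.comp continuous_charFn)).continuousAt) hO
  -- The minimum with `ν` makes the same rate `c` serve for the heat symbol.
  refine ⟨min ν (max C 1)⁻¹, by positivity, min_le_left _ _, fun z hz => ?_⟩
  rcases eq_or_ne z 0 with rfl | hz0
  · simp [Real.zero_rpow hα.ne', charFn_re_le_one]
  have hz' : 0 < ‖z‖ := norm_pos_iff.2 hz0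
  have h1 := hC z hz hz0
  have hpos := hne z hz hz0
  rw [Complex.norm_real, norm_inv, Real.norm_of_nonneg hpos.le, Real.rpow_neg hz'.le] at h1
  have h2 : (1 - (charFn μ z).re)⁻¹ ≤ max C 1 * (‖z‖ ^ α)⁻¹ := by
    refine h1.trans ?_
    gcongr
    exact le_max_left _ _
  rw [inv_le_comm₀ hpos (by positivity), mul_inv, inv_inv] at h2
  refine le_trans ?_ h2
  gcongr
  exact min_le_right _ _

lemma Assumption2.contDiffAt_charFn (h : Assumption2 μ α ν a) {z : Space d} (hz : z ∈ bigCube d)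
    (hz0 : z ≠ 0) : ContDiffAt ℝ (d + 3 : ℕ) (charFn μ) z := by
  obtain ⟨w, hw, hw0, n, rfl⟩ := exists_cube_translate hz hz0
  have h1 : ContDiffAt ℝ (d + 3 : ℕ) (charFn μ) w := by
    have e : charFn μ = fun z => remainder μ α ν z + 1 - ν * normPow α z := by
      ext z; simp only [remainder]; ring
    rw [e]
    exact ((h.contDiffAt w hw hw0).add contDiffAt_const).sub
      (contDiffAt_const.mul (contDiffAt_normPow α hw0 _))
  have e : charFn μ = charFn μ ∘ fun z => z - (2 * Real.pi) • toSpace n := by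
    ext z
    have := charFn_add_period (μ := μ) (z - (2 * Real.pi) • toSpace n) n
    simpa using this
  rw [e]
  refine ContDiffAt.comp _ ?_ (by fun_prop)
  simpa using h1

lemma Assumption2.exists_derivRemainder_le (h : Assumption2 μ α ν a) :
    ∃ C : ℝ, 0 < C ∧ ∀ k : ℕ, 1 ≤ k → k ≤ d + 3 → ∀ i : Fin d, ∀ z ∈ bigCube d, z ≠ 0 →
      ‖derivRemainder μ α ν k i z‖ ≤ C * ‖z‖ ^ (α + a - k) := by
  have key : ∀ (k : ℕ) (i : Fin d), ∃ C : ℝ, 1 ≤ k → k ≤ d + 3 → ∀ z ∈ bigCube d, z ≠ 0 →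
      ‖derivRemainder μ α ν k i z‖ ≤ C * ‖z‖ ^ (α + a - k) := by
    intro k i
    by_cases hk : 1 ≤ k ∧ k ≤ d + 3
    · obtain ⟨C, hC⟩ := exists_bound_on_bigCube (fun z hz hz0 => by
        refine (continuousAt_partialDeriv (i := i) ((h.contDiffAt_charFn hz hz0).of_le ?_)).add
          (continuousAt_const.mul (continuousAt_partialDeriv (contDiffAt_normPow α hz0 k)))
        exact_mod_cast hk.2) (h.derivRemainder_isBigO k hk.1 hk.2 i)
      exact ⟨C, fun _ _ => hC⟩
    · exact ⟨0, fun h1 h2 => absurd ⟨h1, h2⟩ hk⟩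
  choose C hC using key
  refine ⟨1 + ∑ k ∈ Finset.range (d + 4), ∑ i, |C k i|, by positivity, ?_⟩
  intro k h1 h2 i z hz hz0
  refine (hC k i h1 h2 z hz hz0).trans ?_
  gcongr
  have e1 : |C k i| ≤ ∑ i, |C k i| :=
    Finset.single_le_sum (f := fun i => |C k i|) (fun _ _ => abs_nonneg _) (Finset.mem_univ i)
  have e2 : ∑ i, |C k i| ≤ ∑ k ∈ Finset.range (d + 4), ∑ i, |C k i| :=
    Finset.single_le_sum (f := fun k => ∑ i, |C k i|)
      (fun _ _ => Finset.sum_nonneg fun _ _ => abs_nonneg _) (Finset.mem_range.2 (by omega))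
  linarith [le_abs_self (C k i)]

lemma exists_norm_partialDeriv_normPow_le_uniform (d : ℕ) (α : ℝ) (n : ℕ) :
    ∃ C : ℝ, 0 < C ∧ ∀ k ≤ n, ∀ (i : Fin d) (z : Space d), z ≠ 0 →
      ‖partialDeriv k i (normPow α) z‖ ≤ C * ‖z‖ ^ (α - k) := by
  choose C hC using exists_norm_partialDeriv_normPow_le (d := d) α
  refine ⟨1 + ∑ k ∈ Finset.range (n + 1), ∑ i, |C k i|, by positivity, ?_⟩
  intro k h1 i z hz0
  refine (hC k i z hz0).trans ?_
  gcongr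
  have e1 : |C k i| ≤ ∑ i, |C k i| :=
    Finset.single_le_sum (f := fun i => |C k i|) (fun _ _ => abs_nonneg _) (Finset.mem_univ i)
  have e2 : ∑ i, |C k i| ≤ ∑ k ∈ Finset.range (n + 1), ∑ i, |C k i| :=
    Finset.single_le_sum (f := fun k => ∑ i, |C k i|)
      (fun _ _ => Finset.sum_nonneg fun _ _ => abs_nonneg _) (Finset.mem_range.2 (by omega))
  linarith [le_abs_self (C k i)]

end CharFn

/-! ### Estimates of the symbols `exp (s (μ̂ - 1))` and `exp (-s ν |z|^α)` -/

/-- The characteristic function of the walk at time `s`. -/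
noncomputable def walkSymbol {d : ℕ} (μ : Measure (Fin d → ℤ)) (s : ℝ) (z : Space d) : ℂ :=
  Complex.exp (s * (charFn μ z - 1))

/-- The Fourier transform of the heat kernel at time `s`. -/
noncomputable def heatSymbol {d : ℕ} (α ν s : ℝ) (z : Space d) : ℂ :=
  Complex.exp (s * -(ν * normPow α z))

lemma exists_rpow_mul_exp_neg_le (p : ℝ) (hp : 0 ≤ p) {c : ℝ} (hc : 0 < c) :
    ∃ C : ℝ, 0 < C ∧ ∀ x : ℝ, 0 ≤ x → x ^ p * Real.exp (-(c * x)) ≤ C := by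
  obtain ⟨n, hn⟩ := exists_nat_ge p
  refine ⟨1 + n.factorial / c ^ n, by positivity, fun x hx => ?_⟩
  have h1 : x ^ p ≤ 1 + x ^ n := by
    rcases le_total x 1 with h | h
    · have := Real.rpow_le_one hx h hp
      have : 0 ≤ x ^ n := by positivity
      linarith
    · have := Real.rpow_le_rpow_of_exponent_le h hn
      rw [Real.rpow_natCast] at this
      linarith
  have h2 : x ^ n * Real.exp (-(c * x)) ≤ n.factorial / c ^ n := by
    have := Real.pow_div_factorial_le_exp (c * x) (by positivity) n
    rw [div_le_iff₀ (by positivity), mul_pow] at this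
    rw [Real.exp_neg, ← div_eq_mul_inv, div_le_div_iff₀ (Real.exp_pos _) (by positivity)]
    linarith
  have h3 : Real.exp (-(c * x)) ≤ 1 := Real.exp_le_one_iff.2 (by nlinarith)
  calc x ^ p * Real.exp (-(c * x)) ≤ (1 + x ^ n) * Real.exp (-(c * x)) := by gcongr
    _ = Real.exp (-(c * x)) + x ^ n * Real.exp (-(c * x)) := by ring
    _ ≤ _ := by linarith

/-- Differentiating the exponentials produces powers of `1 + B x` with `x = s |z|^α`; the
exponential decay absorbs them uniformly in `s`. -/
lemma exists_one_add_pow_mul_exp_neg_le (m : ℕ) {B c : ℝ} (hB : 0 ≤ B) (hc : 0 < c) :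
    ∃ C : ℝ, 0 < C ∧ ∀ x : ℝ, 0 ≤ x → (1 + B * x) ^ m * Real.exp (-(c * x)) ≤ C := by
  obtain ⟨C, hC0, hC⟩ := exists_rpow_mul_exp_neg_le m (by positivity) hc
  refine ⟨2 ^ m * (1 + B ^ m * C), by positivity, fun x hx => ?_⟩
  have h1 : (1 + B * x) ^ m ≤ 2 ^ m * (1 + B ^ m * x ^ m) := by
    rw [← mul_pow]
    have := add_pow_le (zero_le_one) (by positivity : 0 ≤ B * x) m
    refine this.trans ?_
    rw [one_pow]
    gcongr
    · norm_num
    · omega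
  have h2 := hC x hx
  rw [Real.rpow_natCast] at h2
  have h3 : Real.exp (-(c * x)) ≤ 1 := Real.exp_le_one_iff.2 (by nlinarith)
  calc _ ≤ 2 ^ m * (1 + B ^ m * x ^ m) * Real.exp (-(c * x)) := by gcongr
    _ = 2 ^ m * (Real.exp (-(c * x)) + B ^ m * (x ^ m * Real.exp (-(c * x)))) := by ring
    _ ≤ _ := by gcongr

/-- Mean value inequality on the convex half plane `Re ≤ M`, where `|exp'| ≤ exp M`. -/
lemma norm_exp_sub_exp_le {f g : ℂ} {M : ℝ} (hf : f.re ≤ M) (hg : g.re ≤ M) :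
    ‖Complex.exp f - Complex.exp g‖ ≤ Real.exp M * ‖f - g‖ := by
  refine (convex_halfSpace_re_le M).norm_image_sub_le_of_norm_deriv_le (f := Complex.exp)
    (fun z _ => Complex.differentiableAt_exp) (fun z hz => ?_) hg hf
  rw [Complex.deriv_exp, Complex.norm_exp]
  exact Real.exp_le_exp.2 hz

section Symbols

variable {d : ℕ} {μ : Measure (Fin d → ℤ)} {α ν a : ℝ}

lemma heatSymbol_eq_ofReal (s : ℝ) (z : Space d) :
    heatSymbol α ν s z = (Real.exp (-s * ν * ‖z‖ ^ α) : ℂ) := by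
  rw [heatSymbol, normPow, Complex.ofReal_exp]
  congr 1
  push_cast
  ring

lemma norm_heatSymbol (s : ℝ) (z : Space d) :
    ‖heatSymbol α ν s z‖ = Real.exp (-(s * ν * ‖z‖ ^ α)) := by
  rw [heatSymbol_eq_ofReal, Complex.norm_real, Real.norm_of_nonneg (Real.exp_pos _).le]
  ring_nf

lemma re_mul_charFn_sub_one (s : ℝ) (z : Space d) :
    ((s : ℂ) * (charFn μ z - 1)).re = -(s * (1 - (charFn μ z).re)) := by
  simp
  ring

lemma re_mul_neg_normPow (s : ℝ) (z : Space d) :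
    ((s : ℂ) * -(ν * normPow α z)).re = -(s * (ν * ‖z‖ ^ α)) := by
  rw [normPow, ← Complex.ofReal_mul, ← Complex.ofReal_neg, ← Complex.ofReal_mul, Complex.ofReal_re]
  ring

lemma exponent_sub (s : ℝ) (z : Space d) :
    (s : ℂ) * (charFn μ z - 1) - s * -(ν * normPow α z) = s * remainder μ α ν z := by
  rw [remainder]; ring

/-- The basic comparison of the two symbols. -/
lemma norm_walkSymbol_sub_heatSymbol_le {c B s : ℝ} {z : Space d} (hs : 0 ≤ s) (hcν : c ≤ ν)
    (hc : c * ‖z‖ ^ α ≤ 1 - (charFn μ z).re)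
    (hB : ‖remainder μ α ν z‖ ≤ B * ‖z‖ ^ (α + a)) :
    ‖walkSymbol μ s z - heatSymbol α ν s z‖ ≤
      Real.exp (-(c * (s * ‖z‖ ^ α))) * (B * s * ‖z‖ ^ (α + a)) := by
  have h := norm_exp_sub_exp_le (f := s * (charFn μ z - 1)) (g := s * -(ν * normPow α z))
    (M := -(c * (s * ‖z‖ ^ α))) (by rw [re_mul_charFn_sub_one]; nlinarith)
    (by
      rw [re_mul_neg_normPow]
      have : 0 ≤ s * ‖z‖ ^ α := by positivity
      nlinarith)
  rw [exponent_sub, norm_mul, Complex.norm_real, Real.norm_of_nonneg hs] at h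
  refine h.trans ?_
  rw [mul_comm B s, mul_assoc s B]
  gcongr

variable [IsProbabilityMeasure μ]

lemma continuous_walkSymbol (s : ℝ) : Continuous (walkSymbol μ s) :=
  Complex.continuous_exp.comp (continuous_const.mul (continuous_charFn.sub continuous_const))

lemma norm_walkSymbol_le_one {s : ℝ} (hs : 0 ≤ s) (z : Space d) : ‖walkSymbol μ s z‖ ≤ 1 := by
  rw [walkSymbol, Complex.norm_exp, re_mul_charFn_sub_one, Real.exp_le_one_iff]
  nlinarith [charFn_re_le_one (μ := μ) z]

end Symbols

section Derivatives

variable {d : ℕ} {μ : Measure (Fin d → ℤ)} {α ν a : ℝ}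

lemma contDiffAt_heatSymbol (s : ℝ) {z : Space d} (hz : z ≠ 0) (n : WithTop ℕ∞) :
    ContDiffAt ℝ n (heatSymbol α ν s) z :=
  (contDiffAt_const.mul (contDiffAt_const.mul (contDiffAt_normPow α hz n)).neg).cexp

lemma Assumption2.contDiffAt_walkSymbol (h : Assumption2 μ α ν a) (s : ℝ) {z : Space d}
    (hz : z ∈ bigCube d) (hz0 : z ≠ 0) : ContDiffAt ℝ (d + 3 : ℕ) (walkSymbol μ s) z :=
  (contDiffAt_const.mul ((h.contDiffAt_charFn hz hz0).sub contDiffAt_const)).cexp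

/-- Puts the exponent in the form asked for by the bounds on derivatives of exponentials, with `ρ =
|z|` and `K` proportional to `s |z|^α`. -/
lemma norm_iteratedDeriv_heatExponent_le {C s : ℝ} (hs : 0 ≤ s) (hν : 0 < ν) {j : ℕ} {i : Fin d}
    {z : Space d} (hz : z ≠ 0) (hC : ‖partialDeriv j i (normPow α) z‖ ≤ C * ‖z‖ ^ (α - j)) :
    ‖iteratedDeriv j (fun u : ℝ => (s : ℂ) *
      -(ν * normPow α (z + u • EuclideanSpace.single i (1 : ℝ)))) 0‖ ≤
      ν * C * (s * ‖z‖ ^ α) / ‖z‖ ^ j := by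
  have e : (fun u : ℝ => (s : ℂ) * -(ν * normPow α (z + u • EuclideanSpace.single i (1 : ℝ)))) =
      fun u : ℝ => (-(s * ν) : ℂ) * normPow α (z + u • EuclideanSpace.single i (1 : ℝ)) := by
    ext u; ring
  rw [e, iteratedDeriv_const_mul_field, ← partialDeriv, norm_mul, norm_neg, norm_mul,
    Complex.norm_real, Complex.norm_real, Real.norm_of_nonneg hs, Real.norm_of_nonneg hν.le]
  rw [Real.rpow_sub (norm_pos_iff.2 hz), Real.rpow_natCast] at hC
  calc s * ν * _ ≤ s * ν * (C * (‖z‖ ^ α / ‖z‖ ^ j)) := by gcongr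
    _ = _ := by ring

/-- Derivatives of the symbol of the heat kernel. -/
lemma exists_norm_partialDeriv_heatSymbol_le (d : ℕ) (α : ℝ) (hν : 0 < ν) (m : ℕ) :
    ∃ A : ℝ, 0 < A ∧ ∀ s : ℝ, 0 ≤ s → ∀ (i : Fin d) (z : Space d), z ≠ 0 →
      ‖partialDeriv m i (heatSymbol α ν s) z‖ ≤ A / ‖z‖ ^ m := by
  obtain ⟨C, hC0, hC⟩ := exists_norm_partialDeriv_normPow_le_uniform d α m
  obtain ⟨D, hD0, hD⟩ := exists_norm_iteratedDeriv_exp_le m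
  obtain ⟨M, hM0, hM⟩ := exists_one_add_pow_mul_exp_neg_le m (B := ν * C) (by positivity) hν
  refine ⟨D * M + 1, by positivity, fun s hs i z hz => ?_⟩
  have hz' : 0 < ‖z‖ := norm_pos_iff.2 hz
  have hx : 0 ≤ s * ‖z‖ ^ α := by positivity
  have h := hD (fun u : ℝ => (s : ℂ) * -(ν * normPow α (z + u • EuclideanSpace.single i (1 : ℝ))))
    0 ‖z‖ (ν * C * (s * ‖z‖ ^ α)) (Real.exp (-(ν * (s * ‖z‖ ^ α)))) hz' (by positivity)
    (contDiffAt_const.mul (contDiffAt_const.mul (contDiffAt_comp_line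
      (by simpa using contDiffAt_normPow α hz m))).neg)
    (fun j _ hj => norm_iteratedDeriv_heatExponent_le hs hν hz (hC j hj i z hz))
    (by
      rw [Complex.norm_exp, re_mul_neg_normPow]
      simp only [zero_smul, add_zero]
      exact Real.exp_le_exp.2 (by linarith))
  refine h.trans ?_
  gcongr
  have := hM _ hx
  calc _ = D * ((1 + ν * C * (s * ‖z‖ ^ α)) ^ m * Real.exp (-(ν * (s * ‖z‖ ^ α)))) := by ring
    _ ≤ D * M := by gcongr
    _ ≤ _ := by linarith

lemma norm_le_of_mem_bigCube : ∃ R : ℝ, 1 ≤ R ∧ ∀ z ∈ bigCube d, ‖z‖ ≤ R := by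
  obtain ⟨R, hR⟩ := (isCompact_bigCube (d := d)).isBounded.exists_norm_le
  exact ⟨max R 1, le_max_right _ _, fun z hz => (hR z hz).trans (le_max_left _ _)⟩

/-- Derivatives of the difference of the symbols. -/
lemma exists_norm_partialDeriv_symbol_sub_le [IsProbabilityMeasure μ] (h1 : Assumption1 μ α ν a)
    (h2 : Assumption2 μ α ν a) (hα : 0 < α) (hν : 0 < ν) (ha : 0 < a) :
    ∃ A : ℝ, 0 < A ∧ ∀ s : ℝ, 0 ≤ s → ∀ (i : Fin d), ∀ z ∈ bigCube d, z ≠ 0 →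
      ‖partialDeriv (d + 3) i (walkSymbol μ s) z - partialDeriv (d + 3) i (heatSymbol α ν s) z‖ ≤
        A * s * ‖z‖ ^ (α + a - (d + 3 : ℕ)) := by
  obtain ⟨C, hC0, hC⟩ := exists_norm_partialDeriv_normPow_le_uniform d α (d + 3)
  obtain ⟨D, hD0, hD⟩ := exists_norm_iteratedDeriv_exp_sub_exp_le (d + 3)
  obtain ⟨c, hc0, hcν, hc⟩ := h1.exists_le_one_sub_re hα ha hν
  obtain ⟨B₀, hB₀0, hB₀⟩ := h1.exists_remainder_le hα
  obtain ⟨B₁, hB₁0, hB₁⟩ := h2.exists_derivRemainder_le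
  obtain ⟨R, hR1, hR⟩ := norm_le_of_mem_bigCube (d := d)
  let B := max B₀ B₁
  have hB0 : 0 < B := lt_max_of_lt_left hB₀0
  -- One constant for both exponents: the derivatives of `f` are those of `g` plus an error with an
  -- extra factor `|z|^a ≤ R^a`.
  let L := ν * C + B * R ^ a
  have hL0 : 0 < L := by positivity
  obtain ⟨M, hM0, hM⟩ := exists_one_add_pow_mul_exp_neg_le (d + 3) hL0.le hc0
  refine ⟨D * B * M + 1, by positivity, fun s hs i z hz hz0 => ?_⟩
  have hz' : 0 < ‖z‖ := norm_pos_iff.2 hz0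
  have hx : 0 ≤ s * ‖z‖ ^ α := by positivity
  let f : ℝ → ℂ := fun u => (s : ℂ) * (charFn μ (z + u • EuclideanSpace.single i (1 : ℝ)) - 1)
  let g : ℝ → ℂ := fun u => (s : ℂ) * -(ν * normPow α (z + u • EuclideanSpace.single i (1 : ℝ)))
  have hcf : ContDiffAt ℝ (d + 3 : ℕ)
      (fun u : ℝ => charFn μ (z + u • EuclideanSpace.single i (1 : ℝ))) 0 :=
    contDiffAt_comp_line (by simpa using h2.contDiffAt_charFn hz hz0)
  have hf : ContDiffAt ℝ (d + 3 : ℕ) f 0 := contDiffAt_const.mul (hcf.sub contDiffAt_const)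
  have hg : ContDiffAt ℝ (d + 3 : ℕ) g 0 :=
    contDiffAt_const.mul (contDiffAt_const.mul (contDiffAt_comp_line
      (by simpa using contDiffAt_normPow α hz0 _))).neg
  have hdiff : ∀ j, 1 ≤ j → j ≤ d + 3 → ‖iteratedDeriv j f 0 - iteratedDeriv j g 0‖ ≤
      B * (s * ‖z‖ ^ (α + a)) / ‖z‖ ^ j := by
    intro j hj1 hj2
    have ef : iteratedDeriv j f 0 = s * partialDeriv j i (charFn μ) z := by
      have := iteratedDeriv_const_mul_field (n := j) (x := (0 : ℝ)) (s : ℂ)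
        (fun u : ℝ => charFn μ (z + u • EuclideanSpace.single i (1 : ℝ)) - 1)
      rw [show f = fun u : ℝ => (s : ℂ) *
        (charFn μ (z + u • EuclideanSpace.single i (1 : ℝ)) - 1) from rfl, this, partialDeriv]
      congr 1
      simp_rw [sub_eq_add_neg, add_comm (charFn μ _)]
      exact iteratedDeriv_const_add (by omega) _
    have eg : iteratedDeriv j g 0 = s * -(ν * partialDeriv j i (normPow α) z) := by
      have e : g = fun u : ℝ => (-(s * ν) : ℂ) *
          normPow α (z + u • EuclideanSpace.single i (1 : ℝ)) := by
        ext u; simp only [g]; ring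
      rw [e, iteratedDeriv_const_mul_field, ← partialDeriv]
      ring
    have := hB₁ j hj1 hj2 i z hz hz0
    have e : iteratedDeriv j f 0 - iteratedDeriv j g 0 = s * derivRemainder μ α ν j i z := by
      rw [ef, eg, derivRemainder]; ring
    rw [e, norm_mul, Complex.norm_real, Real.norm_of_nonneg hs]
    rw [Real.rpow_sub hz', Real.rpow_natCast] at this
    calc _ ≤ s * (B₁ * (‖z‖ ^ (α + a) / ‖z‖ ^ j)) := by gcongr
      _ ≤ s * (B * (‖z‖ ^ (α + a) / ‖z‖ ^ j)) := by gcongr; exact le_max_right _ _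
      _ = _ := by ring
  have hδ : B * (s * ‖z‖ ^ (α + a)) ≤ B * R ^ a * (s * ‖z‖ ^ α) := by
    rw [Real.rpow_add hz']
    calc _ = B * ‖z‖ ^ a * (s * ‖z‖ ^ α) := by ring
      _ ≤ _ := by gcongr; exact hR z hz
  have hgj : ∀ j, 1 ≤ j → j ≤ d + 3 → ‖iteratedDeriv j g 0‖ ≤
      ν * C * (s * ‖z‖ ^ α) / ‖z‖ ^ j := fun j _ hj2 =>
    norm_iteratedDeriv_heatExponent_le hs hν hz0 (hC j hj2 i z hz0)
  -- The scales are `ρ = |z|`, `K = L s |z|^α`, `δ = B s |z|^(α+a)` and `E = exp (-c s |z|^α)`.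
  have key := hD f g 0 ‖z‖ (L * (s * ‖z‖ ^ α)) (B * (s * ‖z‖ ^ (α + a)))
    (Real.exp (-(c * (s * ‖z‖ ^ α)))) hz' (by positivity) hf hg
    (fun j hj1 hj2 => by
      have h3 := hdiff j hj1 hj2
      have h4 := hgj j hj1 hj2
      have h5 : ‖iteratedDeriv j f 0‖ ≤ ‖iteratedDeriv j f 0 - iteratedDeriv j g 0‖ +
          ‖iteratedDeriv j g 0‖ := by
        simpa using norm_add_le (iteratedDeriv j f 0 - iteratedDeriv j g 0) (iteratedDeriv j g 0)
      refine h5.trans ((add_le_add h3 h4).trans ?_)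
      rw [← add_div]
      gcongr
      simp only [L]
      linarith)
    (fun j hj1 hj2 => (hgj j hj1 hj2).trans (by
      gcongr
      simp only [L]
      have : 0 ≤ B * R ^ a := by positivity
      linarith))
    hdiff
    (by
      rw [Complex.norm_exp, re_mul_charFn_sub_one]
      simp only [zero_smul, add_zero]
      exact Real.exp_le_exp.2 (by nlinarith [hc z hz]))
    (by
      rw [Complex.norm_exp, re_mul_neg_normPow]
      simp only [zero_smul, add_zero]
      exact Real.exp_le_exp.2 (by nlinarith))
    (by
      simp only [f, g, zero_smul, add_zero]
      refine (norm_walkSymbol_sub_heatSymbol_le hs hcν (hc z hz) (hB₀ z hz)).trans ?_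
      rw [mul_assoc B₀]
      gcongr
      exact le_max_left _ _)
  refine key.trans ?_
  rw [Real.rpow_sub hz', Real.rpow_natCast]
  have := hM _ hx
  calc _ = D * B * ((1 + L * (s * ‖z‖ ^ α)) ^ (d + 3) * Real.exp (-(c * (s * ‖z‖ ^ α)))) * s *
        (‖z‖ ^ (α + a) / ‖z‖ ^ (d + 3)) := by ring
    _ ≤ D * B * M * s * (‖z‖ ^ (α + a) / ‖z‖ ^ (d + 3)) := by gcongr
    _ ≤ _ := by gcongr; linarith

end Derivatives

/-! ### The difference of the transition probabilities as a Fourier integral -/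

section Integrals

variable {d : ℕ}

/-- The exponential beats every power, so the function is dominated by a multiple of `(1 +
|z|)^(-(d+1))`. -/
lemma integrable_rpow_mul_exp_neg {α β c : ℝ} (hα : 0 < α) (hβ : 0 ≤ β) (hc : 0 < c) :
    Integrable fun z : Space d => ‖z‖ ^ β * Real.exp (-(c * ‖z‖ ^ α)) := by
  have hb : ∀ p : ℝ, 0 ≤ p → ∃ C : ℝ, 0 < C ∧ ∀ z : Space d,
      ‖z‖ ^ p * Real.exp (-(c * ‖z‖ ^ α)) ≤ C := by
    intro p hp
    obtain ⟨C, hC0, hC⟩ := exists_rpow_mul_exp_neg_le (p / α) (by positivity) hc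
    refine ⟨C, hC0, fun z => ?_⟩
    have := hC (‖z‖ ^ α) (by positivity)
    rwa [← Real.rpow_mul (norm_nonneg z), mul_div_cancel₀ _ hα.ne'] at this
  obtain ⟨C₁, hC₁0, hC₁⟩ := hb β hβ
  obtain ⟨C₂, hC₂0, hC₂⟩ := hb (β + (d + 1)) (by positivity)
  have h_int := integrable_one_add_norm (E := Space d) (μ := volume) (r := d + 1)
    (by simp)
  refine (h_int.const_mul (2 ^ (d + 1) * (C₁ + C₂))).mono' ?_ (ae_of_all _ fun z => ?_)
  · refine Continuous.aestronglyMeasurable ?_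
    exact (continuous_norm.rpow_const fun _ => Or.inr hβ).mul (Real.continuous_exp.comp
      (continuous_const.mul (continuous_norm.rpow_const fun _ => Or.inr hα.le)).neg)
  · rw [Real.norm_of_nonneg (by positivity), Real.rpow_neg (by positivity), ← div_eq_mul_inv,
      le_div_iff₀ (by positivity)]
    have h1 : (1 + ‖z‖) ^ ((d : ℝ) + 1) ≤ 2 ^ (d + 1) * (1 + ‖z‖ ^ ((d : ℝ) + 1)) := by
      have e : ((d : ℝ) + 1) = ((d + 1 : ℕ) : ℝ) := by push_cast; ring
      rw [e, Real.rpow_natCast, Real.rpow_natCast]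
      refine (add_pow_le zero_le_one (norm_nonneg z) (d + 1)).trans ?_
      rw [one_pow]
      gcongr
      · norm_num
      · omega
    have h2 : ‖z‖ ^ (β + ((d : ℝ) + 1)) = ‖z‖ ^ β * ‖z‖ ^ ((d : ℝ) + 1) :=
      Real.rpow_add_of_nonneg (norm_nonneg z) hβ (by positivity)
    have h3 := hC₂ z
    rw [h2] at h3
    have h4 := hC₁ z
    calc ‖z‖ ^ β * Real.exp (-(c * ‖z‖ ^ α)) * (1 + ‖z‖) ^ ((d : ℝ) + 1)
        ≤ ‖z‖ ^ β * Real.exp (-(c * ‖z‖ ^ α)) * (2 ^ (d + 1) * (1 + ‖z‖ ^ ((d : ℝ) + 1))) := by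
          gcongr
      _ = 2 ^ (d + 1) * (‖z‖ ^ β * Real.exp (-(c * ‖z‖ ^ α)) +
          ‖z‖ ^ β * ‖z‖ ^ ((d : ℝ) + 1) * Real.exp (-(c * ‖z‖ ^ α))) := by ring
      _ ≤ _ := by gcongr

lemma continuous_heatSymbol {α ν : ℝ} (hα : 0 < α) (s : ℝ) :
    Continuous (heatSymbol α ν s : Space d → ℂ) :=
  Complex.continuous_exp.comp
    (continuous_const.mul (continuous_const.mul (continuous_normPow hα)).neg)

lemma integrable_heatSymbol {α ν s : ℝ} (hα : 0 < α) (hν : 0 < ν) (hs : 0 < s) :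
    Integrable (heatSymbol α ν s : Space d → ℂ) := by
  have h := integrable_rpow_mul_exp_neg (d := d) hα le_rfl (mul_pos hs hν)
  refine h.mono' (continuous_heatSymbol hα s).aestronglyMeasurable (ae_of_all _ fun z => ?_)
  rw [norm_heatSymbol, Real.rpow_zero, one_mul]

end Integrals

section Inversion

variable {d : ℕ} {μ : Measure (Fin d → ℤ)} {α ν s : ℝ}

/-- The character `z ↦ exp (-i k·z)`. -/
noncomputable def character (k : Fin d → ℤ) (z : Space d) : ℂ :=
  Complex.exp (-Complex.I * (inner ℝ (toSpace k) z : ℝ))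

lemma norm_character (k : Fin d → ℤ) (z : Space d) : ‖character k z‖ = 1 :=
  norm_exp_neg_I_mul _

lemma continuous_character (k : Fin d → ℤ) : Continuous (character k) := by
  unfold character; fun_prop

lemma integrable_character_mul {f : Space d → ℂ} {κ : Measure (Space d)} (hf : Integrable f κ)
    (k : Fin d → ℤ) : Integrable (fun z => character k z * f z) κ :=
  hf.bdd_mul (continuous_character k).aestronglyMeasurable
    (ae_of_all _ fun z => (norm_character k z).le)

lemma exp_inner_nsmul (v : Space d) (k : Fin d → ℤ) (j : ℕ) :
    Complex.exp (Complex.I * (inner ℝ (j • v) (toSpace k) : ℝ)) =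
      Complex.exp (Complex.I * (inner ℝ v (toSpace k) : ℝ)) ^ j := by
  rw [← Complex.exp_nat_mul, ← Nat.cast_smul_eq_nsmul ℝ, inner_smul_left]
  congr 1
  simp
  ring

/-- A shift by `v` multiplies the `l`-th Fourier coefficient by the unimodular number `exp (i v·l)`.
The domain stays the same cube, so no boundary term appears. -/
lemma integral_character_mul_walkSymbol_shift {q : (Fin d → ℤ) → ℝ} (hq : Summable fun l => ‖q l‖)
    (hG : ∀ z, ∑' l, Complex.exp (Complex.I * (inner ℝ z (toSpace l) : ℝ)) * (q l : ℂ) =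
      walkSymbol μ s z) (k : Fin d → ℤ) (v : Space d) :
    ∫ z in cube d, character k z * walkSymbol μ s (z + v) =
      Complex.exp (Complex.I * (inner ℝ v (toSpace k) : ℝ)) * ((2 * (Real.pi : ℂ)) ^ d * q k) := by
  have h := integral_cube_fourierSeries
    (fun l => Complex.exp (Complex.I * (inner ℝ v (toSpace l) : ℝ)) * (q l : ℂ)) (by
      simp_rw [norm_mul, norm_exp_I_mul, one_mul, Complex.norm_real]
      exact hq) k
  rw [show Complex.exp (Complex.I * (inner ℝ v (toSpace k) : ℝ)) * ((2 * (Real.pi : ℂ)) ^ d * q k) =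
    (2 * (Real.pi : ℂ)) ^ d * (Complex.exp (Complex.I * (inner ℝ v (toSpace k) : ℝ)) * q k) by ring,
    ← h]
  congr with z
  rw [character, ← hG]
  congr 2 with l
  rw [← mul_assoc, ← Complex.exp_add, inner_add_left]
  push_cast
  ring_nf

/-- The counterpart of the preceding identity on the whole space, from translation invariance of
Lebesgue measure. -/
lemma integral_character_mul_shift (f : Space d → ℂ) (k : Fin d → ℤ) (v : Space d) :
    ∫ z, character k z * f (z + v) =
      Complex.exp (Complex.I * (inner ℝ v (toSpace k) : ℝ)) * ∫ z, character k z * f z := by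
  rw [← integral_const_mul, ← integral_add_right_eq_self (fun z => _ * (character k z * f z)) v]
  congr with z
  rw [← mul_assoc]
  congr 1
  rw [character, character, ← Complex.exp_add, inner_add_right, real_inner_comm v]
  push_cast
  ring_nf

lemma integrable_fwdDiff_iter {f : Space d → ℂ} {κ : Measure (Space d)} {v : Space d}
    (hf : ∀ j : ℕ, Integrable (fun z => f (z + j • v)) κ) (m : ℕ) :
    Integrable ((fwdDiff v)^[m] f) κ := by
  have e : (fwdDiff v)^[m] f = fun z => ∑ j ∈ Finset.range (m + 1),
      ((-1 : ℤ) ^ (m - j) * m.choose j) • f (z + j • v) := by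
    ext z; exact fwdDiff_iter_eq_sum_shift v f m z
  rw [e]
  exact integrable_finsetSum _ fun j _ => (hf j).smul _

/-- Forward differences act on Fourier integrals by multiplication. -/
lemma integral_character_mul_fwdDiff_iter {f : Space d → ℂ} {κ : Measure (Space d)} {v : Space d}
    {k : Fin d → ℤ} {w : ℂ} (hf : ∀ j : ℕ, Integrable (fun z => f (z + j • v)) κ)
    (hw : ∀ v, ∫ z, character k z * f (z + v) ∂κ =
      Complex.exp (Complex.I * (inner ℝ v (toSpace k) : ℝ)) * w) (m : ℕ) :
    ∫ z, character k z * (fwdDiff v)^[m] f z ∂κ =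
      (Complex.exp (Complex.I * (inner ℝ v (toSpace k) : ℝ)) - 1) ^ m * w := by
  simp_rw [fwdDiff_iter_eq_sum_shift, Finset.mul_sum]
  have e : ∀ (j : ℕ) (z : Space d), character k z *
      (((-1 : ℤ) ^ (m - j) * m.choose j) • f (z + j • v)) =
      ((-1 : ℂ) ^ (m - j) * m.choose j) * (character k z * f (z + j • v)) := by
    intro j z
    rw [zsmul_eq_mul]
    push_cast
    ring
  simp_rw [e]
  rw [integral_finsetSum _ fun j _ => (integrable_character_mul (hf j) k).const_mul _]
  simp_rw [integral_const_mul, hw, exp_inner_nsmul]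
  rw [sub_eq_add_neg, add_pow, Finset.sum_mul]
  exact Finset.sum_congr rfl fun j _ => by ring

/-- A pointwise bound of the difference of iterated forward differences of the symbols bounds the
difference of the transition probabilities. -/
lemma norm_pow_mul_abs_sub_heatKernel_le [IsProbabilityMeasure μ] {q : (Fin d → ℤ) → ℝ}
    (hq : Summable fun l => ‖q l‖)
    (hG : ∀ z, ∑' l, Complex.exp (Complex.I * (inner ℝ z (toSpace l) : ℝ)) * (q l : ℂ) =
      walkSymbol μ s z) (hα : 0 < α) (hν : 0 < ν) (hs : 0 < s) (k : Fin d → ℤ) (v : Space d) (m : ℕ)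
    {Φ : Space d → ℝ} (hΦ : Integrable Φ)
    (hb : ∀ z, ‖(cube d).indicator ((fwdDiff v)^[m] (walkSymbol μ s)) z -
      (fwdDiff v)^[m] (heatSymbol α ν s) z‖ ≤ Φ z) :
    ‖Complex.exp (Complex.I * (inner ℝ v (toSpace k) : ℝ)) - 1‖ ^ m *
      |q k - heatKernel α ν s (toSpace k)| ≤ ((2 * Real.pi) ^ d)⁻¹ * ∫ z, Φ z := by
  have : IsFiniteMeasure (volume.restrict (cube d)) := ⟨by simpa using volume_cube_lt_top⟩
  have hGi : ∀ j : ℕ, Integrable (fun z => walkSymbol μ s (z + j • v))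
      (volume.restrict (cube d)) := fun j =>
    (integrable_const (1 : ℝ)).mono' ((continuous_walkSymbol s).comp
      (continuous_id.add continuous_const)).aestronglyMeasurable
      (ae_of_all _ fun z => norm_walkSymbol_le_one hs.le _)
  have hHi : ∀ j : ℕ, Integrable (fun z => heatSymbol α ν s (z + j • v)) volume := fun j =>
    (integrable_heatSymbol hα hν hs).comp_add_right _
  set ω := Complex.exp (Complex.I * (inner ℝ v (toSpace k) : ℝ))
  have h1 := integral_character_mul_fwdDiff_iter hGi
    (integral_character_mul_walkSymbol_shift hq hG k) m
  have h2 := integral_character_mul_fwdDiff_iter hHi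
    (integral_character_mul_shift (heatSymbol α ν s) k) m
  have i1 := integrable_character_mul (integrable_fwdDiff_iter hGi m) k
  have i2 := integrable_character_mul (integrable_fwdDiff_iter hHi m) k
  -- The cutoff is applied after differencing. Both Fourier integrals now live on the whole space
  -- and can be subtracted under one integral.
  rw [← integral_indicator measurableSet_cube] at h1
  rw [← IntegrableOn, ← integrable_indicator_iff measurableSet_cube] at i1
  have h3 : ∫ z, character k z * ((cube d).indicator ((fwdDiff v)^[m] (walkSymbol μ s)) z -
      (fwdDiff v)^[m] (heatSymbol α ν s) z) =
      (ω - 1) ^ m * ((2 * (Real.pi : ℂ)) ^ d * q k -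
        ∫ z, character k z * heatSymbol α ν s z) := by
    rw [mul_sub, ← h1, ← h2, ← integral_sub i1 i2]
    congr with z
    by_cases hz : z ∈ cube d <;> simp [hz, mul_sub]
  have h4 : ‖(ω - 1) ^ m * ((2 * (Real.pi : ℂ)) ^ d * q k -
        ∫ z, character k z * heatSymbol α ν s z)‖ ≤ ∫ z, Φ z := by
    rw [← h3]
    refine norm_integral_le_of_norm_le hΦ (ae_of_all _ fun z => ?_)
    rw [norm_mul, norm_character, one_mul]
    exact hb z
  rw [norm_mul, norm_pow] at h4
  have hk : heatKernel α ν s (toSpace k) = ((2 * Real.pi) ^ d)⁻¹ *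
      (∫ z, character k z * heatSymbol α ν s z).re := by
    simp_rw [heatKernel, character, heatSymbol_eq_ofReal]
  have hpi : 0 < (2 * Real.pi) ^ d := by positivity
  -- The heat kernel is defined by a real part, and passing to real parts only decreases the
  -- modulus.
  have h5 : (2 * Real.pi) ^ d * |q k - heatKernel α ν s (toSpace k)| ≤
      ‖(2 * (Real.pi : ℂ)) ^ d * q k - ∫ z, character k z * heatSymbol α ν s z‖ := by
    refine le_trans (le_of_eq ?_) (Complex.abs_re_le_norm _)
    have e : ((2 * (Real.pi : ℂ)) ^ d * q k).re = (2 * Real.pi) ^ d * q k := by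
      rw [← Complex.ofReal_re ((2 * Real.pi) ^ d * q k)]; push_cast; rfl
    rw [Complex.sub_re, e, hk, ← abs_of_pos hpi, ← abs_mul, abs_of_pos hpi]
    congr 1
    field_simp
  rw [inv_mul_eq_div, le_div_iff₀ hpi]
  calc _ = ‖ω - 1‖ ^ m * ((2 * Real.pi) ^ d * |q k - heatKernel α ν s (toSpace k)|) := by ring
    _ ≤ _ := by gcongr
    _ ≤ _ := h4

end Inversion

/-! ### The two error bounds at lattice spacing one -/

section Scaling

variable {d : ℕ}

/-- Substitute `z ↦ s^(1/α) z`: the Jacobian gives `s^(-d/α)` and the surplus power `|z|^a` gives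
`s^(-a/α)`. -/
lemma integral_rpow_mul_exp_neg_scale {α a c s : ℝ} (hα : 0 < α) (hs : 0 < s) :
    ∫ z : Space d, s * ‖z‖ ^ (α + a) * Real.exp (-(c * (s * ‖z‖ ^ α))) =
      s ^ (-((d + a) / α)) * ∫ z : Space d, ‖z‖ ^ (α + a) * Real.exp (-(c * ‖z‖ ^ α)) := by
  have hR : 0 < s ^ (1 / α) := by positivity
  have h := Measure.integral_comp_smul (volume : Measure (Space d))
    (fun z => ‖z‖ ^ (α + a) * Real.exp (-(c * ‖z‖ ^ α))) (s ^ (1 / α))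
  have e1 : (s ^ (1 / α)) ^ α = s := by
    rw [← Real.rpow_mul hs.le, one_div, inv_mul_cancel₀ hα.ne', Real.rpow_one]
  have e2 : ∀ z : Space d, ‖s ^ (1 / α) • z‖ ^ (α + a) *
      Real.exp (-(c * ‖s ^ (1 / α) • z‖ ^ α)) =
      s ^ (a / α) * (s * ‖z‖ ^ (α + a) * Real.exp (-(c * (s * ‖z‖ ^ α)))) := by
    intro z
    rw [norm_smul, Real.norm_of_nonneg hR.le, Real.mul_rpow hR.le (norm_nonneg _),
      Real.mul_rpow hR.le (norm_nonneg _), e1, Real.rpow_add hR, e1, ← Real.rpow_mul hs.le,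
      one_div_mul_eq_div]
    ring
  simp_rw [e2, integral_const_mul] at h
  simp only [finrank_euclideanSpace, Fintype.card_fin, smul_eq_mul] at h
  have e3 : |((s ^ (1 / α)) ^ d)⁻¹| = s ^ (-(d / α)) := by
    rw [abs_of_pos (by positivity), ← Real.rpow_natCast, ← Real.rpow_mul hs.le,
      ← Real.rpow_neg hs.le]
    congr 1; ring
  rw [e3] at h
  have e4 : s ^ (-((d + a) / α)) = s ^ (-(a / α)) * s ^ (-(d / α)) := by
    rw [← Real.rpow_add hs]; congr 1; ring
  rw [e4, mul_assoc, ← h, ← mul_assoc, ← Real.rpow_add hs]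
  simp

lemma integrable_add_norm_rpow_neg {h r : ℝ} (hh : 0 < h) (hr : d < r) :
    Integrable fun z : Space d => (h + ‖z‖) ^ (-r) := by
  have h1 := (integrable_one_add_norm (E := Space d) (μ := volume) (r := r)
    (by simpa using hr))
  have h2 := (h1.comp_smul (R := h⁻¹) (inv_ne_zero hh.ne')).const_mul (h ^ (-r))
  refine h2.congr (ae_of_all _ fun z => ?_)
  simp only
  rw [norm_smul, Real.norm_of_nonneg (by positivity), ← Real.mul_rpow hh.le (by positivity)]
  congr 1
  field_simp

lemma integral_add_norm_rpow_neg {h r : ℝ} (hh : 0 < h) :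
    ∫ z : Space d, (h + ‖z‖) ^ (-r) = h ^ (d - r) * ∫ z : Space d, (1 + ‖z‖) ^ (-r) := by
  have h1 := Measure.integral_comp_smul (volume : Measure (Space d))
    (fun z => (h + ‖z‖) ^ (-r)) h
  have e : ∀ z : Space d, (h + ‖h • z‖) ^ (-r) = h ^ (-r) * (1 + ‖z‖) ^ (-r) := by
    intro z
    rw [norm_smul, Real.norm_of_nonneg hh.le, ← Real.mul_rpow hh.le (by positivity)]
    congr 1; ring
  simp_rw [e, integral_const_mul] at h1
  simp only [finrank_euclideanSpace, Fintype.card_fin, smul_eq_mul] at h1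
  rw [abs_of_pos (by positivity)] at h1
  rw [sub_eq_add_neg, Real.rpow_add hh, Real.rpow_natCast, mul_assoc, h1]
  field_simp

end Scaling

section Bounds

variable {d : ℕ} {μ : Measure (Fin d → ℤ)} {α ν a : ℝ}

lemma mem_cube_of_norm_lt {z : Space d} (hz : ‖z‖ < Real.pi) : z ∈ cube d := fun i => by
  have h1 := PiLp.norm_apply_le z i
  rw [Real.norm_eq_abs] at h1
  have h2 := abs_lt.1 (h1.trans_lt hz)
  exact ⟨h2.1, h2.2.le⟩

lemma norm_single_smul (i : Fin d) (u : ℝ) :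
    ‖u • (EuclideanSpace.single i (1 : ℝ) : Space d)‖ = |u| := by
  rw [norm_smul, PiLp.norm_single]; simp

/-- The margin `1/2` of the large cube leaves room for all shifts made by the iterated differences.
-/
lemma add_mem_bigCube {z : Space d} (hz : z ∈ cube d) {i : Fin d} {u : ℝ} (hu : |u| ≤ 1 / 2) :
    z + u • EuclideanSpace.single i (1 : ℝ) ∈ bigCube d := fun j => by
  have h1 : |z j| ≤ Real.pi := abs_le.2 ⟨(hz j).1.le, (hz j).2⟩
  have h2 := PiLp.norm_apply_le (u • (EuclideanSpace.single i (1 : ℝ) : Space d)) j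
  rw [norm_single_smul, Real.norm_eq_abs] at h2
  exact (abs_add_le _ _).trans (add_le_add h1 (h2.trans hu))

/-- Uniform error bound. -/
lemma Assumption1.exists_uniform_bound [IsProbabilityMeasure μ] (h1 : Assumption1 μ α ν a)
    (hα : 0 < α) (hν : 0 < ν) (ha : 0 < a) :
    ∃ C : ℝ, 0 < C ∧ ∀ s : ℝ, 1 ≤ s → ∀ q : (Fin d → ℤ) → ℝ, (Summable fun l => ‖q l‖) →
      (∀ z, ∑' l, Complex.exp (Complex.I * (inner ℝ z (toSpace l) : ℝ)) * (q l : ℂ) =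
        walkSymbol μ s z) → ∀ k : Fin d → ℤ,
      |q k - heatKernel α ν s (toSpace k)| ≤ C * s ^ (-((d + a) / α)) := by
  obtain ⟨c, hc0, hcν, hc⟩ := h1.exists_le_one_sub_re hα ha hν
  obtain ⟨B, hB0, hB⟩ := h1.exists_remainder_le hα
  let J := ∫ z : Space d, ‖z‖ ^ (α + a) * Real.exp (-(c * ‖z‖ ^ α))
  have hJ : 0 ≤ J := integral_nonneg fun z => by positivity
  refine ⟨((2 * Real.pi) ^ d)⁻¹ * (max B 1 * J) + 1, by positivity, fun s hs q hq hG k => ?_⟩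
  have hs0 : 0 < s := by linarith
  have h_int : Integrable fun z : Space d =>
      max B 1 * (s * ‖z‖ ^ (α + a) * Real.exp (-(c * (s * ‖z‖ ^ α)))) := by
    refine Integrable.const_mul ?_ _
    refine ((integrable_rpow_mul_exp_neg (d := d) hα (β := α + a) (by positivity)
      (mul_pos hc0 hs0)).const_mul s).congr (ae_of_all _ fun z => ?_)
    simp only
    rw [mul_assoc c]
    ring
  -- With differences of order `m = 0`, this is plain Fourier inversion.
  have key := norm_pow_mul_abs_sub_heatKernel_le hq hG hα hν hs0 k 0 0 h_int (fun z => by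
    simp only [Function.iterate_zero, id_eq]
    by_cases hz : z ∈ cube d
    · rw [Set.indicator_of_mem hz]
      have hz' := cube_subset_bigCube hz
      refine (norm_walkSymbol_sub_heatSymbol_le hs0.le hcν (hc z hz') (hB z hz')).trans ?_
      calc _ = B * (s * ‖z‖ ^ (α + a) * Real.exp (-(c * (s * ‖z‖ ^ α)))) := by ring
        _ ≤ _ := by gcongr; exact le_max_left _ _
    -- Outside the cube only the heat symbol is left. There `|z| ≥ 1` and `s ≥ 1`, so the same
    -- majorant works once its constant is at least `1`; hence `max B 1`.
    · rw [Set.indicator_of_notMem hz, zero_sub, norm_neg, norm_heatSymbol]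
      have hz1 : 1 ≤ ‖z‖ := by
        have : Real.pi ≤ ‖z‖ := not_lt.1 fun h => hz (mem_cube_of_norm_lt h)
        linarith [Real.pi_gt_three]
      have hz2 : 1 ≤ ‖z‖ ^ (α + a) := Real.one_le_rpow hz1 (by positivity)
      have hx : 0 ≤ s * ‖z‖ ^ α := by positivity
      calc Real.exp (-(s * ν * ‖z‖ ^ α)) ≤ 1 * (1 * 1 * Real.exp (-(c * (s * ‖z‖ ^ α)))) := by
            rw [one_mul, one_mul, one_mul, Real.exp_le_exp]; nlinarith
        _ ≤ _ := by gcongr; exact le_max_right _ _)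
  rw [pow_zero, one_mul, integral_const_mul, integral_rpow_mul_exp_neg_scale hα hs0] at key
  refine key.trans ?_
  have : 0 ≤ s ^ (-((d + a) / α)) := by positivity
  calc _ = ((2 * Real.pi) ^ d)⁻¹ * (max B 1 * J) * s ^ (-((d + a) / α)) := by simp only [J]; ring
    _ ≤ _ := by gcongr; linarith

lemma fwdDiff_iter_smul_single (f : Space d → ℂ) (i : Fin d) (h : ℝ) (m : ℕ) (z : Space d) :
    (fwdDiff (h • (EuclideanSpace.single i (1 : ℝ) : Space d)))^[m] f z =
      (fwdDiff h)^[m] (fun u : ℝ => f (z + u • EuclideanSpace.single i (1 : ℝ))) 0 := by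
  rw [fwdDiff_iter_eq_sum_shift, fwdDiff_iter_eq_sum_shift]
  simp [smul_smul, ← Nat.cast_smul_eq_nsmul ℝ]

lemma norm_fwdDiff_iter_le_two_pow (f : Space d → ℂ) (v : Space d) (m : ℕ) (z : Space d) {M : ℝ}
    (hM : ∀ j ≤ m, ‖f (z + j • v)‖ ≤ M) : ‖(fwdDiff v)^[m] f z‖ ≤ 2 ^ m * M := by
  rw [fwdDiff_iter_eq_sum_shift]
  have e : (2 : ℝ) ^ m * M = ∑ j ∈ Finset.range (m + 1), (m.choose j : ℝ) * M := by
    rw [← Finset.sum_mul]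
    congr 1
    exact_mod_cast (Nat.sum_range_choose m).symm
  rw [e]
  refine (norm_sum_le _ _).trans (Finset.sum_le_sum fun j hj => ?_)
  rw [zsmul_eq_mul, norm_mul]
  push_cast
  rw [norm_mul, norm_pow, norm_neg, norm_one, one_pow, one_mul, Complex.norm_natCast]
  gcongr
  exact hM j (by simpa [Nat.lt_succ_iff] using hj)

lemma fwdDiff_iter_sub (f g : Space d → ℂ) (v : Space d) (m : ℕ) (z : Space d) :
    (fwdDiff v)^[m] f z - (fwdDiff v)^[m] g z = (fwdDiff v)^[m] (f - g) z := by
  simp_rw [fwdDiff_iter_eq_sum_shift, ← Finset.sum_sub_distrib, ← smul_sub]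
  rfl

/-- The pointwise bound of the difference of the iterated differences of the symbols. -/
lemma exists_norm_fwdDiff_symbol_sub_le [IsProbabilityMeasure μ] (h1 : Assumption1 μ α ν a)
    (h2 : Assumption2 μ α ν a) (hα : 0 < α) (hα2 : α ≤ 2) (hν : 0 < ν) (ha : 0 < a) (ha1 : a < 1) :
    ∃ A : ℝ, 0 < A ∧ ∀ s h : ℝ, 1 ≤ s → 0 < h → 6 * (d + 3) * h ≤ 1 → ∀ (i : Fin d) (z : Space d),
      ‖(cube d).indicator ((fwdDiff (h • (EuclideanSpace.single i (1 : ℝ) : Space d)))^[d + 3]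
          (walkSymbol μ s)) z -
        (fwdDiff (h • (EuclideanSpace.single i (1 : ℝ) : Space d)))^[d + 3] (heatSymbol α ν s) z‖ ≤
      A * (s * h ^ (d + 3)) * (h + ‖z‖) ^ (-((d + 3 : ℕ) - (α + a))) := by
  obtain ⟨A₁, hA₁0, hA₁⟩ := exists_norm_partialDeriv_symbol_sub_le h1 h2 hα hν ha
  obtain ⟨A₂, hA₂0, hA₂⟩ := exists_norm_partialDeriv_heatSymbol_le (ν := ν) d α hν (d + 3)
  obtain ⟨c, hc0, hcν, hc⟩ := h1.exists_le_one_sub_re hα ha hν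
  obtain ⟨B, hB0, hB⟩ := h1.exists_remainder_le hα
  set m : ℕ := d + 3 with hm
  have hmR : (m : ℝ) = d + 3 := by rw [hm]; push_cast; ring
  have hm0 : (0 : ℝ) < m := by rw [hmR]; positivity
  set r : ℝ := m - (α + a) with hr
  have hr0 : 0 < r := by rw [hr, hmR]; have : (0 : ℝ) ≤ d := by positivity
                         linarith
  refine ⟨max (max A₁ A₂ * (4 : ℝ) ^ r) (2 ^ m * (B * (3 * m) ^ (α + a) * (2 * m + 1) ^ r)),
    by positivity, fun s h hs hh hmh i z => ?_⟩
  have hs0 : 0 < s := by linarith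
  rw [← hmR] at hmh
  have hmh0 : 0 < m * h := by positivity
  have hshift : ∀ u ∈ Set.Icc (0 : ℝ) (0 + m * h),
      ‖z‖ - m * h ≤ ‖z + u • (EuclideanSpace.single i (1 : ℝ) : Space d)‖ := by
    intro u hu
    have h3 := norm_sub_le (z + u • (EuclideanSpace.single i (1 : ℝ) : Space d))
      (u • (EuclideanSpace.single i (1 : ℝ) : Space d))
    rw [add_sub_cancel_right, norm_single_smul, abs_of_nonneg hu.1] at h3
    linarith [hu.2]
  -- Within distance `2mh` of the origin the segment of shifts may meet the singularity, so the `m +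
  -- 1` values are bounded individually; all of them lie within `3mh` of the origin.
  rcases le_or_gt ‖z‖ (2 * m * h) with hz | hz
  · have hzc : z ∈ cube d := mem_cube_of_norm_lt (by nlinarith [Real.pi_gt_three])
    rw [Set.indicator_of_mem hzc, fwdDiff_iter_sub]
    have hb := norm_fwdDiff_iter_le_two_pow (walkSymbol μ s - heatSymbol α ν s)
      (h • (EuclideanSpace.single i (1 : ℝ) : Space d)) m z (M := B * s * (3 * m * h) ^ (α + a))
      (fun j hj => by
        have hjm : (j : ℝ) ≤ m := by exact_mod_cast hj
        have hjh : (j : ℝ) * h ≤ m * h := by gcongr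
        have hjh0 : 0 ≤ (j : ℝ) * h := by positivity
        rw [← Nat.cast_smul_eq_nsmul ℝ, smul_smul]
        have hw : z + ((j : ℝ) * h) • (EuclideanSpace.single i (1 : ℝ) : Space d) ∈ bigCube d :=
          add_mem_bigCube hzc (by rw [abs_of_nonneg hjh0]; linarith)
        have hwn : ‖z + ((j : ℝ) * h) • (EuclideanSpace.single i (1 : ℝ) : Space d)‖ ≤
            3 * m * h := by
          refine (norm_add_le _ _).trans ?_
          rw [norm_single_smul, abs_of_nonneg hjh0]
          linarith
        refine (norm_walkSymbol_sub_heatSymbol_le hs0.le hcν (hc _ hw) (hB _ hw)).trans ?_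
        have : Real.exp (-(c * (s * ‖z + ((j : ℝ) * h) •
            (EuclideanSpace.single i (1 : ℝ) : Space d)‖ ^ α))) ≤ 1 :=
          Real.exp_le_one_iff.2 (neg_nonpos.2 (by positivity))
        calc _ ≤ 1 * (B * s * (3 * m * h) ^ (α + a)) := by gcongr
          _ = _ := one_mul _)
    refine hb.trans ?_
    have h5 : (2 * m + 1 : ℝ) ^ (-r) * h ^ (-r) ≤ (h + ‖z‖) ^ (-r) := by
      rw [← Real.mul_rpow (by positivity) hh.le]
      exact Real.rpow_le_rpow_of_nonpos (by positivity) (by linarith) (by linarith)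
    have h6 : h ^ (α + a) = h ^ m * h ^ (-r) := by
      rw [← Real.rpow_natCast, ← Real.rpow_add hh]; congr 1; rw [hr]; ring
    have h7 : (2 * m + 1 : ℝ) ^ r * (2 * m + 1 : ℝ) ^ (-r) = 1 := by
      rw [← Real.rpow_add (by positivity)]; simp
    calc 2 ^ m * (B * s * (3 * m * h) ^ (α + a))
        = 2 ^ m * (B * (3 * m) ^ (α + a) * ((2 * m + 1 : ℝ) ^ r * (2 * m + 1 : ℝ) ^ (-r))) *
          (s * h ^ m) * h ^ (-r) := by
          rw [h7, Real.mul_rpow (by positivity) hh.le, h6]; ring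
      _ = 2 ^ m * (B * (3 * m) ^ (α + a) * (2 * m + 1 : ℝ) ^ r) *
          (s * h ^ m) * ((2 * m + 1 : ℝ) ^ (-r) * h ^ (-r)) := by ring
      _ ≤ 2 ^ m * (B * (3 * m) ^ (α + a) * (2 * m + 1 : ℝ) ^ r) *
          (s * h ^ m) * (h + ‖z‖) ^ (-r) := by gcongr
      _ ≤ _ := by gcongr; exact le_max_right _ _
  · have hz0 : 0 < ‖z‖ := by linarith
    -- Away from the origin the whole segment stays at distance at least `|z|/2` from the
    -- singularity, and the derivative bounds apply. As `h ≤ |z|`, this distance is also at least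
    -- `(h + |z|)/4`.
    have hhalf : ∀ u ∈ Set.Icc (0 : ℝ) (0 + m * h),
        ‖z‖ / 2 ≤ ‖z + u • (EuclideanSpace.single i (1 : ℝ) : Space d)‖ := fun u hu => by
      linarith [hshift u hu]
    have hne : ∀ u ∈ Set.Icc (0 : ℝ) (0 + m * h),
        z + u • (EuclideanSpace.single i (1 : ℝ) : Space d) ≠ 0 := fun u hu => by
      have := hhalf u hu
      exact norm_pos_iff.1 (by linarith)
    have hhz : h ≤ ‖z‖ := by
      have : (1 : ℝ) ≤ m := by rw [hmR]; have : (0 : ℝ) ≤ d := by positivity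
                               linarith
      nlinarith
    have h4 : ∀ u ∈ Set.Icc (0 : ℝ) (0 + m * h),
        ‖z + u • (EuclideanSpace.single i (1 : ℝ) : Space d)‖ ^ (-r) ≤
          4 ^ r * (h + ‖z‖) ^ (-r) := by
      intro u hu
      have e : (4 : ℝ) ^ r * (h + ‖z‖) ^ (-r) = ((h + ‖z‖) / 4) ^ (-r) := by
        rw [Real.div_rpow (by positivity) (by positivity), Real.rpow_neg (by norm_num : (0:ℝ) ≤ 4)]
        field_simp
      rw [e]
      exact Real.rpow_le_rpow_of_nonpos (by positivity) (by linarith [hhalf u hu]) (by linarith)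
    suffices hmain : ‖(cube d).indicator ((fwdDiff (h • (EuclideanSpace.single i (1 : ℝ) :
          Space d)))^[m] (walkSymbol μ s)) z -
        (fwdDiff (h • (EuclideanSpace.single i (1 : ℝ) : Space d)))^[m] (heatSymbol α ν s) z‖ ≤
        h ^ m * (max A₁ A₂ * s * (4 ^ r * (h + ‖z‖) ^ (-r))) by
      refine hmain.trans ?_
      calc _ = max A₁ A₂ * (4 : ℝ) ^ r * (s * h ^ m) * (h + ‖z‖) ^ (-r) := by ring
        _ ≤ _ := by gcongr; exact le_max_left _ _
    by_cases hzc : z ∈ cube d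
    · have hbig : ∀ u ∈ Set.Icc (0 : ℝ) (0 + m * h),
          z + u • (EuclideanSpace.single i (1 : ℝ) : Space d) ∈ bigCube d := fun u hu =>
        add_mem_bigCube hzc (by rw [abs_of_nonneg hu.1]; linarith [hu.2])
      rw [Set.indicator_of_mem hzc, fwdDiff_iter_sub, fwdDiff_iter_smul_single]
      have hcw : ∀ u ∈ Set.Icc (0 : ℝ) (0 + m * h), ContDiffAt ℝ m
          (fun u : ℝ => walkSymbol μ s (z + u • EuclideanSpace.single i (1 : ℝ))) u := fun u hu =>
        contDiffAt_comp_line (h2.contDiffAt_walkSymbol s (hbig u hu) (hne u hu))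
      have hch : ∀ u ∈ Set.Icc (0 : ℝ) (0 + m * h), ContDiffAt ℝ m
          (fun u : ℝ => heatSymbol α ν s (z + u • EuclideanSpace.single i (1 : ℝ))) u := fun u hu =>
        contDiffAt_comp_line (contDiffAt_heatSymbol s (hne u hu) _)
      refine norm_fwdDiff_iter_le m hh.le (fun u hu => (hcw u hu).sub (hch u hu))
        (fun u hu => ?_)
      simp only [Pi.sub_apply]
      rw [iteratedDeriv_fun_sub (hcw u hu) (hch u hu), iteratedDeriv_comp_line,
        iteratedDeriv_comp_line]
      refine (hA₁ s hs0.le i _ (hbig u hu) (hne u hu)).trans ?_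
      rw [show α + a - (m : ℝ) = -r by rw [hr]; ring]
      gcongr
      · exact le_max_left _ _
      · exact h4 u hu
    -- Outside the cube there is no cancellation. The bound `|w|^(-m)` for the heat symbol is
    -- enough, because `|w| ≥ 1` and `s ≥ 1`.
    · rw [Set.indicator_of_notMem hzc, zero_sub, norm_neg, fwdDiff_iter_smul_single]
      have hzpi : Real.pi ≤ ‖z‖ := not_lt.1 fun h => hzc (mem_cube_of_norm_lt h)
      refine norm_fwdDiff_iter_le m hh.le
        (fun u hu => contDiffAt_comp_line (contDiffAt_heatSymbol s (hne u hu) _)) fun u hu => ?_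
      rw [iteratedDeriv_comp_line]
      refine (hA₂ s hs0.le i _ (hne u hu)).trans ?_
      have hw1 : 1 ≤ ‖z + u • (EuclideanSpace.single i (1 : ℝ) : Space d)‖ := by
        linarith [hshift u hu, Real.pi_gt_three]
      have h5 := h4 u hu
      generalize ‖z + u • (EuclideanSpace.single i (1 : ℝ) : Space d)‖ = w at *
      have h6 : (w ^ m)⁻¹ ≤ w ^ (-r) := by
        rw [← Real.rpow_natCast, ← Real.rpow_neg (by linarith)]
        exact Real.rpow_le_rpow_of_exponent_le hw1 (by rw [hr]; linarith)
      calc A₂ / w ^ m = A₂ * 1 * (w ^ m)⁻¹ := by ring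
        _ ≤ max A₁ A₂ * s * (4 ^ r * (h + ‖z‖) ^ (-r)) := by
          gcongr
          · exact le_max_right _ _
          · exact h6.trans h5

/-- Take a coordinate of largest modulus; the Euclidean norm is at most the sum of the moduli. -/
lemma exists_norm_le_mul_abs {k : Fin d → ℤ} (hk : k ≠ 0) :
    ∃ i, k i ≠ 0 ∧ ‖(toSpace k : Space d)‖ ≤ d * |(k i : ℝ)| := by
  obtain ⟨j, hj⟩ := Function.ne_iff.1 hk
  obtain ⟨i, -, hi⟩ := Finset.exists_max_image Finset.univ (fun i => |(k i : ℝ)|) ⟨j, Finset.mem_univ j⟩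
  have hi0 : k i ≠ 0 := by
    intro h0
    have := hi j (Finset.mem_univ j)
    rw [h0] at this
    simp at this
    exact hj this
  refine ⟨i, hi0, ?_⟩
  have e : (toSpace k : Space d) = ∑ l, (k l : ℝ) • EuclideanSpace.single l (1 : ℝ) := by
    ext l
    simp [toSpace, Pi.single_apply]
  rw [e]
  refine (norm_sum_le _ _).trans ?_
  simp_rw [norm_single_smul]
  refine (Finset.sum_le_card_nsmul _ _ _ hi).trans ?_
  simp

/-- This step is half a period of the character in direction `i`, so the factor `exp (i v·k) - 1`
has its largest modulus, `2`. -/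
lemma exp_inner_half_period {k : Fin d → ℤ} {i : Fin d} (hi : k i ≠ 0) :
    Complex.exp (Complex.I * (inner ℝ ((Real.pi / |(k i : ℝ)|) •
      (EuclideanSpace.single i (1 : ℝ) : Space d)) (toSpace k) : ℝ)) = -1 := by
  have e : (inner ℝ ((Real.pi / |(k i : ℝ)|) • (EuclideanSpace.single i (1 : ℝ) : Space d))
      (toSpace k) : ℝ) = Real.pi / |(k i : ℝ)| * k i := by
    rw [inner_smul_left, EuclideanSpace.inner_single_left]; simp [toSpace]
  rw [e]
  have h0 : (k i : ℝ) ≠ 0 := by exact_mod_cast hi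
  rcases lt_or_gt_of_ne h0 with hneg | hpos
  · have : Real.pi / |(k i : ℝ)| * k i = -Real.pi := by
      rw [abs_of_neg hneg]; field_simp
    rw [this]; push_cast
    rw [mul_neg, Complex.exp_neg, mul_comm, Complex.exp_pi_mul_I]; norm_num
  · have : Real.pi / |(k i : ℝ)| * k i = Real.pi := by
      rw [abs_of_pos hpos]; field_simp
    rw [this, mul_comm, Complex.exp_pi_mul_I]

/-- Error bound away from the origin. -/
lemma exists_decay_bound [IsProbabilityMeasure μ] (h1 : Assumption1 μ α ν a)
    (h2 : Assumption2 μ α ν a) (hα : 0 < α) (hα2 : α ≤ 2) (hν : 0 < ν) (ha : 0 < a) (ha1 : a < 1) :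
    ∃ C : ℝ, 0 < C ∧ ∀ s : ℝ, 1 ≤ s → ∀ q : (Fin d → ℤ) → ℝ, (Summable fun l => ‖q l‖) →
      (∀ z, ∑' l, Complex.exp (Complex.I * (inner ℝ z (toSpace l) : ℝ)) * (q l : ℂ) =
        walkSymbol μ s z) → ∀ k : Fin d → ℤ, k ≠ 0 →
      |q k - heatKernel α ν s (toSpace k)| ≤ C * (s / ‖(toSpace k : Space d)‖ ^ (d + α + a)) := by
  obtain ⟨C₁, hC₁0, hC₁⟩ := h1.exists_uniform_bound hα hν ha
  obtain ⟨A, hA0, hA⟩ := exists_norm_fwdDiff_symbol_sub_le h1 h2 hα hα2 hν ha ha1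
  set m : ℕ := d + 3 with hm
  have hmR : (m : ℝ) = d + 3 := by rw [hm]; push_cast; ring
  set r : ℝ := m - (α + a) with hr
  -- The order `d + 3` enters here: `α + a < 3` makes `(h + |z|)^(-r)` integrable.
  have hr0 : d < r := by rw [hr, hmR]; linarith
  let J := ∫ z : Space d, (1 + ‖z‖) ^ (-r)
  have hJ : 0 ≤ J := integral_nonneg fun z => by positivity
  let R : ℝ := d * (6 * (d + 3) * Real.pi)
  have hCR : 0 ≤ C₁ * R ^ (d + α + a) := by positivity
  refine ⟨((2 * Real.pi) ^ d)⁻¹ * (A * J) * (d * Real.pi) ^ (d + α + a) +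
    C₁ * R ^ (d + α + a) + 1, by positivity, fun s hs q hq hG k hk => ?_⟩
  have hs0 : 0 < s := by linarith
  obtain ⟨i, hi0, hi⟩ := exists_norm_le_mul_abs hk
  have hki : 0 < |(k i : ℝ)| := abs_pos.2 (by exact_mod_cast hi0)
  have hkn : 0 < ‖(toSpace k : Space d)‖ := by
    refine norm_pos_iff.2 fun h0 => hi0 ?_
    have := congrArg (fun v : Space d => v i) h0
    simpa [toSpace] using this
  set n := ‖(toSpace k : Space d)‖ with hn
  -- The step `h = π / |k_i|` is admissible exactly when `|k_i|` is large. The remaining sites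
  -- satisfy `|k| ≤ R`, and for them the uniform bound suffices.
  rcases le_or_gt (6 * (d + 3) * Real.pi) |(k i : ℝ)| with hbig | hsmall
  · let h := Real.pi / |(k i : ℝ)|
    have hh : 0 < h := by positivity
    have hmh : 6 * (d + 3) * h ≤ 1 := by
      simp only [h]
      rw [← mul_div_assoc, div_le_one hki]; exact hbig
    have h_int : Integrable fun z : Space d => A * (s * h ^ m) * (h + ‖z‖) ^ (-r) :=
      (integrable_add_norm_rpow_neg hh hr0).const_mul _
    have key := norm_pow_mul_abs_sub_heatKernel_le hq hG hα hν hs0 k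
      (h • (EuclideanSpace.single i (1 : ℝ) : Space d)) m h_int (hA s h hs hh hmh i)
    rw [exp_inner_half_period hi0, show ‖(-1 : ℂ) - 1‖ = 2 by norm_num, integral_const_mul,
      integral_add_norm_rpow_neg hh] at key
    -- The difference of order `m` gives `h^m`, and rescaling the integral gives `h^(d-r)`.
    have e1 : h ^ m * h ^ (d - r) = h ^ (d + α + a) := by
      rw [← Real.rpow_natCast, ← Real.rpow_add hh]; congr 1; rw [hr]; ring
    have hhn : h ≤ d * Real.pi / n := by
      rw [le_div_iff₀ hkn]
      calc h * n ≤ h * (d * |(k i : ℝ)|) := by gcongr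
        _ = d * Real.pi := by simp only [h]; field_simp
    have e2 : h ^ (d + α + a) ≤ (d * Real.pi) ^ (d + α + a) / n ^ (d + α + a) := by
      rw [← Real.div_rpow (by positivity) hkn.le]
      gcongr
    have h2m : (1 : ℝ) ≤ 2 ^ m := one_le_pow₀ (by norm_num)
    change _ ≤ ((2 * Real.pi) ^ d)⁻¹ * (A * (s * h ^ m) * (h ^ (d - r) * J)) at key
    clear_value h J R
    calc |q k - heatKernel α ν s (toSpace k)| ≤ 2 ^ m * |q k - heatKernel α ν s (toSpace k)| :=
          le_mul_of_one_le_left (abs_nonneg _) h2m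
      _ ≤ _ := key
      _ = ((2 * Real.pi) ^ d)⁻¹ * (A * J) * s * (h ^ m * h ^ (d - r)) := by ring
      _ ≤ ((2 * Real.pi) ^ d)⁻¹ * (A * J) * s * ((d * Real.pi) ^ (d + α + a) / n ^ (d + α + a)) := by
          rw [e1]; gcongr
      _ = ((2 * Real.pi) ^ d)⁻¹ * (A * J) * (d * Real.pi) ^ (d + α + a) *
          (s / n ^ (d + α + a)) := by ring
      _ ≤ _ := by
          gcongr
          linarith
  · have hnR : n ≤ R := hi.trans (by simp only [R]; gcongr)
    have hR0 : 0 < R := hkn.trans_le hnR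
    clear_value J R
    have h3 := hC₁ s hs q hq hG k
    have h4 : s ^ (-((d + a) / α)) ≤ 1 :=
      Real.rpow_le_one_of_one_le_of_nonpos hs (by have : 0 ≤ (d + a) / α := by positivity
                                                  linarith)
    have h5 : 1 ≤ R ^ (d + α + a) / n ^ (d + α + a) := by
      rw [one_le_div (by positivity)]; gcongr
    calc _ ≤ _ := h3
      _ ≤ C₁ * 1 := by gcongr
      _ ≤ C₁ * (s * (R ^ (d + α + a) / n ^ (d + α + a))) := by
          gcongr; nlinarith
      _ = C₁ * R ^ (d + α + a) * (s / n ^ (d + α + a)) := by ring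
      _ ≤ _ := by
          gcongr
          have : 0 ≤ ((2 * Real.pi) ^ d)⁻¹ * (A * J) * (d * Real.pi) ^ (d + α + a) := by positivity
          linarith

end Bounds

/-! ### Functions with nonnegative cosine transform -/

section CosTransform

variable {d : ℕ}

/-- The cosine transform `x ↦ ∫ cos (x·z) φ(z) dz`. -/
noncomputable def cosTransform (φ : Space d → ℝ) (x : Space d) : ℝ :=
  ∫ z, Real.cos (inner ℝ x z) * φ z

/-- `φ` is integrable, with a nonnegative cosine transform. -/
structure IsCosPositive (φ : Space d → ℝ) : Prop where
  integrable : Integrable φ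
  nonneg : ∀ x, 0 ≤ cosTransform φ x

variable {φ J : Space d → ℝ}

lemma integrable_cos_mul (hφ : Integrable φ) (x : Space d) :
    Integrable fun z => Real.cos (inner ℝ x z) * φ z :=
  hφ.bdd_mul (c := 1) (Continuous.aestronglyMeasurable (by fun_prop))
    (ae_of_all _ fun z => by simpa using Real.abs_cos_le_one _)

lemma norm_cos_mul_le (x z : Space d) (t : ℝ) : ‖Real.cos (inner ℝ x z) * t‖ ≤ ‖t‖ := by
  rw [norm_mul]
  exact mul_le_of_le_one_left (norm_nonneg _) (by simpa using Real.abs_cos_le_one _)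

lemma abs_cosTransform_le (hφ : Integrable φ) (x : Space d) :
    |cosTransform φ x| ≤ ∫ z, ‖φ z‖ := by
  rw [← Real.norm_eq_abs]
  exact norm_integral_le_of_norm_le hφ.norm (ae_of_all _ fun z => norm_cos_mul_le x z _)

lemma continuous_cosTransform (hφ : Integrable φ) : Continuous (cosTransform φ) :=
  continuous_of_dominated (bound := fun z => ‖φ z‖)
    (fun x => (integrable_cos_mul hφ x).aestronglyMeasurable)
    (fun x => ae_of_all _ fun z => norm_cos_mul_le x z _) hφ.norm
    (ae_of_all _ fun z => by fun_prop)

lemma integrable_cosTransform_mul (hφ : Integrable φ) (hJ : Integrable J) :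
    Integrable fun z => cosTransform J z * φ z :=
  hφ.bdd_mul (continuous_cosTransform hJ).aestronglyMeasurable
    (ae_of_all _ fun z => abs_cosTransform_le hJ z)

/-- The cosine transform turns products with `cosTransform J` into convolutions with `J`. -/
lemma cosTransform_cosTransform_mul (hφ : Integrable φ) (hJ : Integrable J) (x : Space d) :
    cosTransform (fun z => cosTransform J z * φ z) x =
      ∫ y, 1 / 2 * (J y * (cosTransform φ (x + y) + cosTransform φ (x - y))) := by
  have h1 : ∀ z, Real.cos (inner ℝ x z) * (cosTransform J z * φ z) =
      ∫ y, Real.cos (inner ℝ x z) * Real.cos (inner ℝ z y) * (φ z * J y) := by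
    intro z
    rw [cosTransform, ← integral_mul_const, ← integral_const_mul]
    congr with y
    ring
  have h_int : Integrable (Function.uncurry fun z y : Space d =>
      Real.cos (inner ℝ x z) * Real.cos (inner ℝ z y) * (φ z * J y)) (volume.prod volume) := by
    refine (hφ.mul_prod hJ).bdd_mul (c := 1)
      (f := fun p : Space d × Space d => Real.cos (inner ℝ x p.1) * Real.cos (inner ℝ p.1 p.2))
      (Continuous.aestronglyMeasurable (by fun_prop)) (ae_of_all _ fun p => ?_)
    rw [norm_mul]
    exact mul_le_one₀ (by simpa using Real.abs_cos_le_one _) (norm_nonneg _)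
      (by simpa using Real.abs_cos_le_one _)
  rw [cosTransform]
  simp_rw [h1]
  rw [integral_integral_swap h_int]
  congr with y
  rw [cosTransform, cosTransform, ← integral_add (integrable_cos_mul hφ _)
    (integrable_cos_mul hφ _), ← integral_const_mul, ← integral_const_mul]
  congr with z
  rw [inner_add_left, inner_sub_left, Real.cos_add, Real.cos_sub, real_inner_comm y z]
  ring

/-- On the transform side this is a convolution with the nonnegative `J`. -/
lemma IsCosPositive.cosTransform_mul (hφ : IsCosPositive φ) (hJ : Integrable J)
    (hJ0 : ∀ y, 0 ≤ J y) : IsCosPositive fun z => cosTransform J z * φ z where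
  integrable := integrable_cosTransform_mul hφ.integrable hJ
  nonneg x := by
    rw [cosTransform_cosTransform_mul hφ.integrable hJ]
    refine integral_nonneg fun y => ?_
    exact mul_nonneg (by norm_num)
      (mul_nonneg (hJ0 y) (add_nonneg (hφ.nonneg _) (hφ.nonneg _)))

lemma IsCosPositive.const_mul (hφ : IsCosPositive φ) {c : ℝ} (hc : 0 ≤ c) :
    IsCosPositive fun z => c * φ z where
  integrable := hφ.integrable.const_mul c
  nonneg x := by
    have : cosTransform (fun z => c * φ z) x = c * cosTransform φ x := by
      rw [cosTransform, cosTransform, ← integral_const_mul]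
      congr with z
      ring
    rw [this]
    exact mul_nonneg hc (hφ.nonneg x)

lemma IsCosPositive.pow_mul (hφ : IsCosPositive φ) (hJ : Integrable J) (hJ0 : ∀ y, 0 ≤ J y)
    (n : ℕ) : IsCosPositive fun z => cosTransform J z ^ n * φ z := by
  induction n with
  | zero => simpa using hφ
  | succ n ih =>
    have := ih.cosTransform_mul hJ hJ0
    simp_rw [pow_succ', mul_assoc]
    exact this

/-- Multiplication by the characteristic function of a compound Poisson law. -/
lemma IsCosPositive.exp_mul (hφ : IsCosPositive φ) (hJ : Integrable J) (hJ0 : ∀ y, 0 ≤ J y) :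
    IsCosPositive (fun z => Real.exp (cosTransform J z) * φ z) ∧
    ∀ x, cosTransform (fun z => cosTransform J z * φ z) x ≤
      cosTransform (fun z => Real.exp (cosTransform J z) * φ z) x := by
  set L := ∫ z, ‖J z‖
  have hL : 0 ≤ L := integral_nonneg fun z => norm_nonneg _
  have hb := abs_cosTransform_le hJ
  have h_int : Integrable fun z => Real.exp (cosTransform J z) * φ z :=
    hφ.integrable.bdd_mul (c := Real.exp L)
      (Real.continuous_exp.comp (continuous_cosTransform hJ)).aestronglyMeasurable
      (ae_of_all _ fun z => by
        rw [Real.norm_of_nonneg (Real.exp_pos _).le]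
        exact Real.exp_le_exp.2 ((le_abs_self _).trans (hb z)))
  have hterm : ∀ n : ℕ, IsCosPositive fun z =>
      (n.factorial : ℝ)⁻¹ * (cosTransform J z ^ n * φ z) := fun n =>
    (hφ.pow_mul hJ hJ0 n).const_mul (by positivity)
  have hsum : ∀ x, HasSum (fun n : ℕ => cosTransform (fun z =>
      (n.factorial : ℝ)⁻¹ * (cosTransform J z ^ n * φ z)) x)
      (cosTransform (fun z => Real.exp (cosTransform J z) * φ z) x) := by
    intro x
    -- The exponential series is integrated term by term; the `n`-th term is dominated by `L^n / n!`
    -- times the `L¹` norm of `φ`.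
    have h := hasSum_integral_of_summable_integral_norm
      (fun n => integrable_cos_mul (hterm n).integrable x) (by
        refine Summable.of_nonneg_of_le (fun n => integral_nonneg fun z => norm_nonneg _)
          (fun n => ?_) ((NormedSpace.expSeries_div_hasSum_exp L).summable.mul_right (∫ z, ‖φ z‖))
        rw [← integral_const_mul]
        refine integral_mono_of_nonneg (ae_of_all _ fun z => norm_nonneg _)
          (hφ.integrable.norm.const_mul _) (ae_of_all _ fun z => ?_)
        refine (norm_cos_mul_le x z _).trans ?_
        rw [norm_mul, norm_mul, norm_pow, norm_inv, Real.norm_natCast, ← mul_assoc,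
          inv_mul_eq_div]
        simp only
        gcongr
        exact hb z)
    suffices e : cosTransform (fun z => Real.exp (cosTransform J z) * φ z) x =
        ∫ z, ∑' n : ℕ, Real.cos (inner ℝ x z) *
          ((n.factorial : ℝ)⁻¹ * (cosTransform J z ^ n * φ z)) by
      rw [e]; exact h
    rw [cosTransform]
    congr with z
    rw [tsum_mul_left]
    congr 1
    have e : ∀ n : ℕ, (n.factorial : ℝ)⁻¹ * (cosTransform J z ^ n * φ z) =
        cosTransform J z ^ n / n.factorial * φ z := fun n => by ring
    simp_rw [e]
    rw [tsum_mul_right, (NormedSpace.expSeries_div_hasSum_exp (cosTransform J z)).tsum_eq,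
      Real.exp_eq_exp_ℝ]
  refine ⟨⟨h_int, fun x => (hsum x).nonneg fun n => (hterm n).nonneg x⟩, fun x => ?_⟩
  -- Only the term `n = 1`, that of exactly one jump, is kept; the others are nonnegative.
  have := le_hasSum (hsum x) 1 fun n _ => (hterm n).nonneg x
  simpa using this

/-- Functions with nonnegative cosine transform are closed under dominated limits. -/
lemma isCosPositive_of_tendsto {F : ℕ → Space d → ℝ} {bound : Space d → ℝ}
    (hF : ∀ n, IsCosPositive (F n)) (hφ : Integrable φ) (hbound : Integrable bound)
    (hle : ∀ n z, ‖F n z‖ ≤ bound z) (hlim : ∀ z, Tendsto (fun n => F n z) atTop (𝓝 (φ z))) :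
    IsCosPositive φ where
  integrable := hφ
  nonneg x := by
    refine ge_of_tendsto' (f := fun n => cosTransform (F n) x)
      (tendsto_integral_of_dominated_convergence bound
        (fun n => (integrable_cos_mul (hF n).integrable x).aestronglyMeasurable) hbound
        (fun n => ae_of_all _ fun z => (norm_cos_mul_le x z _).trans (hle n z))
        (ae_of_all _ fun z => (hlim z).const_mul _)) fun n => (hF n).nonneg x

lemma isCosPositive_gaussian {b : ℝ} (hb : 0 < b) :
    IsCosPositive fun z : Space d => Real.exp (-(b * ‖z‖ ^ 2)) := by
  have hb' : 0 < (b : ℂ).re := by simpa using hb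
  have hre : ∀ x z : Space d, (Complex.exp (-(b : ℂ) * (‖z‖ : ℂ) ^ 2 +
      Complex.I * (inner ℝ x z : ℝ))).re =
      Real.cos (inner ℝ x z) * Real.exp (-(b * ‖z‖ ^ 2)) := by
    intro x z
    rw [Complex.exp_re]
    have e1 : (-(b : ℂ) * (‖z‖ : ℂ) ^ 2 + Complex.I * (inner ℝ x z : ℝ)).re = -(b * ‖z‖ ^ 2) := by
      simp [← Complex.ofReal_pow]
    have e2 : (-(b : ℂ) * (‖z‖ : ℂ) ^ 2 + Complex.I * (inner ℝ x z : ℝ)).im = inner ℝ x z := by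
      simp [← Complex.ofReal_pow]
    rw [e1, e2, mul_comm]
  constructor
  · have := (GaussianFourier.integrable_cexp_neg_mul_sq_norm_add hb' Complex.I (0 : Space d)).re
    refine this.congr (ae_of_all _ fun z => ?_)
    have := hre 0 z
    simpa using this
  · intro x
    have h1 := GaussianFourier.integral_cexp_neg_mul_sq_norm_add hb' Complex.I x
    have h2 := integral_re (GaussianFourier.integrable_cexp_neg_mul_sq_norm_add hb' Complex.I x)
    rw [h1] at h2
    have h3 : cosTransform (fun z : Space d => Real.exp (-(b * ‖z‖ ^ 2))) x =
        ∫ z : Space d, RCLike.re (Complex.exp (-(b : ℂ) * (‖z‖ : ℂ) ^ 2 +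
          Complex.I * (inner ℝ x z : ℝ))) := by
      rw [cosTransform]
      congr with z
      exact (hre x z).symm
    rw [h3, h2]
    have h4 : ((Real.pi : ℂ) / b) ^ ((Module.finrank ℝ (Space d) : ℂ) / 2) *
        Complex.exp (Complex.I ^ 2 * (‖x‖ : ℂ) ^ 2 / (4 * b)) =
        (((Real.pi / b) ^ ((Module.finrank ℝ (Space d) : ℝ) / 2) *
          Real.exp (-(‖x‖ ^ 2 / (4 * b))) : ℝ) : ℂ) := by
      rw [Complex.ofReal_mul, Complex.ofReal_cpow (by positivity), Complex.ofReal_exp,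
        Complex.I_sq]
      push_cast
      ring_nf
    rw [h4]
    simp only [RCLike.re_eq_complex_re, Complex.ofReal_re]
    positivity

end CosTransform

/-! ### The lower bound of the stable heat kernel -/

section Levy

variable {d : ℕ} {α : ℝ}

/-- The integrand of the Lévy–Khintchine representation of `|z|^α`. -/
noncomputable def levyIntegrand (α : ℝ) (z y : Space d) : ℝ :=
  (1 - Real.cos (inner ℝ z y)) * ‖y‖ ^ (-(d + α))

lemma levyIntegrand_nonneg (z y : Space d) : 0 ≤ levyIntegrand α z y :=
  mul_nonneg (by linarith [Real.cos_le_one (inner ℝ z y)]) (by positivity)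

lemma measurable_levyIntegrand (z : Space d) : Measurable (levyIntegrand α z) := by
  unfold levyIntegrand
  fun_prop

lemma one_sub_cos_inner_le (z y : Space d) :
    1 - Real.cos (inner ℝ z y) ≤ ‖z‖ ^ 2 / 2 * ‖y‖ ^ 2 := by
  have h1 := Real.one_sub_sq_div_two_le_cos (x := inner ℝ z y)
  have h2 : (inner ℝ z y : ℝ) ^ 2 ≤ (‖z‖ * ‖y‖) ^ 2 :=
    sq_le_sq' (neg_le_of_abs_le (abs_real_inner_le_norm z y))
      ((le_abs_self _).trans (abs_real_inner_le_norm z y))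
  rw [mul_pow] at h2
  linarith

/-- Near the origin `1 - cos` is quadratic, and `|y|^(2-d-α)` is integrable because `α < 2`. Far
away `|y|^(-(d+α))` is integrable because `α > 0`. -/
lemma integrable_levyIntegrand (hd : 1 ≤ d) (hα : 0 < α) (hα2 : α < 2) (z : Space d) :
    Integrable (levyIntegrand α z) := by
  rw [← integrableOn_univ, ← Set.union_compl_self (Metric.ball (0 : Space d) 1)]
  refine IntegrableOn.union ?_ ?_
  · refine integrableOn_ball_of_norm_le_rpow (by simpa using hd) (C := ‖z‖ ^ 2 / 2)
      (α := d + α - 2) (by simp; linarith) (ae_of_all _ fun y => ?_)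
      (measurable_levyIntegrand z).aestronglyMeasurable
    rw [Real.norm_of_nonneg (levyIntegrand_nonneg z y), levyIntegrand]
    rcases eq_or_ne y 0 with rfl | hy
    · simp only [inner_zero_right, Real.cos_zero, sub_self, zero_mul]
      positivity
    have hy' : 0 < ‖y‖ := norm_pos_iff.2 hy
    have e : ‖y‖ ^ (-(d + α - 2)) = ‖y‖ ^ 2 * ‖y‖ ^ (-(d + α)) := by
      rw [← Real.rpow_natCast, ← Real.rpow_add hy']; congr 1; push_cast; ring
    rw [e, ← mul_assoc]
    gcongr
    exact one_sub_cos_inner_le z y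
  · have h := (integrable_add_norm_rpow_neg (d := d) one_pos
      (by linarith : (d : ℝ) < d + α)).const_mul (2 * 2 ^ (d + α))
    refine h.integrableOn.mono' (measurable_levyIntegrand z).aestronglyMeasurable ?_
    rw [ae_restrict_iff' Metric.isOpen_ball.measurableSet.compl]
    refine ae_of_all _ fun y hy => ?_
    have hy1 : 1 ≤ ‖y‖ := by simpa using hy
    rw [Real.norm_of_nonneg (levyIntegrand_nonneg z y), levyIntegrand, mul_assoc]
    have h1 : 1 - Real.cos (inner ℝ z y) ≤ 2 := by linarith [Real.neg_one_le_cos (inner ℝ z y)]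
    have h2 : ‖y‖ ^ (-(d + α)) ≤ 2 ^ (d + α) * (1 + ‖y‖) ^ (-(d + α)) := by
      have e : (2 : ℝ) ^ (d + α) * (1 + ‖y‖) ^ (-(d + α)) = ((1 + ‖y‖) / 2) ^ (-(d + α)) := by
        rw [Real.div_rpow (by positivity) (by positivity), Real.rpow_neg (by norm_num : (0:ℝ) ≤ 2)]
        field_simp
      rw [e]
      exact Real.rpow_le_rpow_of_nonpos (by positivity) (by linarith)
        (by have : (0 : ℝ) ≤ d := by positivity
            linarith)
    gcongr

lemma integral_levyIntegrand_smul {r : ℝ} (hr : 0 < r) (z : Space d) :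
    ∫ y, levyIntegrand α (r • z) y = r ^ α * ∫ y, levyIntegrand α z y := by
  have h := Measure.integral_comp_smul (volume : Measure (Space d)) (levyIntegrand α z) r
  have e : ∀ y, levyIntegrand α z (r • y) = r ^ (-(d + α)) * levyIntegrand α (r • z) y := by
    intro y
    simp only [levyIntegrand]
    rw [norm_smul, Real.norm_of_nonneg hr.le, Real.mul_rpow hr.le (norm_nonneg _),
      inner_smul_left, inner_smul_right]
    simp only [conj_trivial]
    ring
  simp_rw [e, integral_const_mul] at h
  simp only [finrank_euclideanSpace, Fintype.card_fin, smul_eq_mul] at h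
  rw [abs_of_pos (by positivity), ← Real.rpow_natCast, ← Real.rpow_neg hr.le] at h
  have e2 : r ^ α = r ^ (d + α) * r ^ (-(d : ℝ)) := by
    rw [← Real.rpow_add hr]; congr 1; ring
  rw [e2, mul_assoc, ← h, ← mul_assoc, ← Real.rpow_add hr]
  simp

/-- Rotation invariance, through the reflection that takes `z` to `w`. With the scaling above it
determines the integral up to a constant. -/
lemma integral_levyIntegrand_of_norm_eq {z w : Space d} (h : ‖z‖ = ‖w‖) :
    ∫ y, levyIntegrand α z y = ∫ y, levyIntegrand α w y := by
  let R : Space d ≃ₗᵢ[ℝ] Space d := (ℝ ∙ (z - w))ᗮ.reflection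
  have hR : R z = w := Submodule.reflection_sub h
  rw [← R.measurePreserving.integral_comp R.toHomeomorph.measurableEmbedding (levyIntegrand α w)]
  congr with y
  simp only [levyIntegrand]
  rw [← hR, LinearIsometryEquiv.inner_map_map, LinearIsometryEquiv.norm_map]

/-- On the ball of radius `1/2` about the unit vector, `y_i` lies in `(1/2, 3/2)`, where the cosine
is not `1`. -/
lemma integral_levyIntegrand_single_pos (hα : 0 < α) (hα2 : α < 2) (i : Fin d) :
    0 < ∫ y, levyIntegrand α (EuclideanSpace.single i (1 : ℝ) : Space d) y := by
  have hd : 1 ≤ d := i.pos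
  rw [integral_pos_iff_support_of_nonneg (levyIntegrand_nonneg _)
    (integrable_levyIntegrand hd hα hα2 _)]
  refine (Metric.measure_ball_pos volume (EuclideanSpace.single i (1 : ℝ) : Space d)
    one_half_pos).trans_le (measure_mono fun y hy => ?_)
  have h1 : |y i - 1| < 1 / 2 := by
    have h2 := PiLp.norm_apply_le (y - (EuclideanSpace.single i (1 : ℝ) : Space d)) i
    rw [mem_ball_iff_norm] at hy
    refine lt_of_le_of_lt ?_ hy
    simpa using h2
  rw [abs_lt] at h1
  have hy0 : y ≠ 0 := by rintro rfl; simp at h1; linarith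
  rw [Function.mem_support, levyIntegrand]
  refine mul_ne_zero ?_ (Real.rpow_pos_of_pos (norm_pos_iff.2 hy0) _).ne'
  have e : inner ℝ (EuclideanSpace.single i (1 : ℝ) : Space d) y = y i := by
    rw [EuclideanSpace.inner_single_left]; simp
  rw [e, sub_ne_zero]
  intro hcos
  have := (Real.cos_eq_one_iff_of_lt_of_lt (by linarith [Real.pi_gt_three])
    (by linarith [Real.pi_gt_three])).1 hcos.symm
  linarith

/-- The Lévy–Khintchine representation of `ν |z|^α`. -/
lemma exists_levy_representation (hd : 1 ≤ d) (hα : 0 < α) (hα2 : α < 2) {ν : ℝ} (hν : 0 < ν) :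
    ∃ κ : ℝ, 0 < κ ∧ ∀ z : Space d, ∫ y, κ * levyIntegrand α z y = ν * ‖z‖ ^ α := by
  let e : Space d := EuclideanSpace.single ⟨0, hd⟩ (1 : ℝ)
  have hI := integral_levyIntegrand_single_pos hα hα2 (⟨0, hd⟩ : Fin d)
  change 0 < ∫ y, levyIntegrand α e y at hI
  refine ⟨ν / ∫ y, levyIntegrand α e y, by positivity, fun z => ?_⟩
  rw [integral_const_mul]
  rcases eq_or_ne z 0 with rfl | hz
  · simp [levyIntegrand, Real.zero_rpow hα.ne']
  have hz' : 0 < ‖z‖ := norm_pos_iff.2 hz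
  have h1 : ‖z‖ = ‖‖z‖ • e‖ := by
    rw [norm_single_smul, abs_of_pos hz']
  rw [integral_levyIntegrand_of_norm_eq h1, integral_levyIntegrand_smul hz']
  field_simp

end Levy

section LowerBound

variable {d : ℕ} {α ν κ : ℝ}

/-- The Lévy density of the stable process, truncated near the origin. -/
noncomputable def jumpDensity (α κ δ : ℝ) (y : Space d) : ℝ := κ * (δ + ‖y‖) ^ (-(d + α))

lemma integrable_jumpDensity (hα : 0 < α) {δ : ℝ} (hδ : 0 < δ) :
    Integrable (jumpDensity α κ δ : Space d → ℝ) :=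
  (integrable_add_norm_rpow_neg hδ (by linarith)).const_mul κ

lemma jumpDensity_nonneg (hκ : 0 < κ) {δ : ℝ} (hδ : 0 < δ) (y : Space d) :
    0 ≤ jumpDensity α κ δ y := by
  unfold jumpDensity; positivity

/-- Makes the difference of two truncated densities again a jump density. -/
lemma jumpDensity_anti (hα : 0 < α) (hκ : 0 < κ) {δ ε : ℝ} (hδ : 0 < δ) (h : δ ≤ ε)
    (y : Space d) : jumpDensity α κ ε y ≤ jumpDensity α κ δ y := by
  unfold jumpDensity
  gcongr 1
  exact Real.rpow_le_rpow_of_nonpos (by positivity) (by linarith) (neg_nonpos.2 (by positivity))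

/-- The exponent `∫ (1 - cos (z·y)) J(y) dy` of the compound Poisson law with jump density `J`. -/
noncomputable def jumpExponent (J : Space d → ℝ) (z : Space d) : ℝ :=
  cosTransform J 0 - cosTransform J z

lemma jumpExponent_eq {J : Space d → ℝ} (hJ : Integrable J) (z : Space d) :
    jumpExponent J z = ∫ y, (1 - Real.cos (inner ℝ z y)) * J y := by
  rw [jumpExponent, cosTransform, cosTransform,
    ← integral_sub (integrable_cos_mul hJ 0) (integrable_cos_mul hJ z)]
  congr with y
  simp
  ring

lemma integrable_jumpExponent_integrand {J : Space d → ℝ} (hJ : Integrable J) (z : Space d) :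
    Integrable fun y => (1 - Real.cos (inner ℝ z y)) * J y := by
  refine (hJ.sub (integrable_cos_mul hJ z)).congr (ae_of_all _ fun y => ?_)
  simp
  ring

lemma jumpExponent_mono {J K : Space d → ℝ} (hJ : Integrable J) (hK : Integrable K)
    (h : ∀ y, J y ≤ K y) (z : Space d) : jumpExponent J z ≤ jumpExponent K z := by
  rw [jumpExponent_eq hJ, jumpExponent_eq hK]
  refine integral_mono (integrable_jumpExponent_integrand hJ z)
    (integrable_jumpExponent_integrand hK z) fun y => ?_
  exact mul_le_mul_of_nonneg_left (h y) (by linarith [Real.cos_le_one (inner ℝ z y)])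

lemma ae_ne_zero (hd : 1 ≤ d) : ∀ᵐ y : Space d, y ≠ 0 := by
  have : Nonempty (Fin d) := ⟨⟨0, hd⟩⟩
  exact Measure.ae_ne volume 0

/-- As the truncation is removed the densities increase to the Lévy density, whose integrand
dominates. -/
lemma tendsto_jumpExponent (hd : 1 ≤ d) (hα : 0 < α) (hα2 : α < 2) (hκ : 0 < κ)
    (hrep : ∀ z : Space d, ∫ y, κ * levyIntegrand α z y = ν * ‖z‖ ^ α) (z : Space d) :
    Tendsto (fun n : ℕ => jumpExponent (jumpDensity α κ (1 / ((n : ℝ) + 1))) z) atTop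
      (𝓝 (ν * ‖z‖ ^ α)) := by
  have hδ : ∀ n : ℕ, 0 < 1 / ((n : ℝ) + 1) := fun n => by positivity
  rw [← hrep z]
  simp_rw [fun n : ℕ => jumpExponent_eq (integrable_jumpDensity (d := d) (κ := κ) hα (hδ n)) z]
  refine tendsto_integral_of_dominated_convergence (fun y => κ * levyIntegrand α z y)
    (fun n => (integrable_jumpExponent_integrand
      (integrable_jumpDensity hα (hδ n)) z).aestronglyMeasurable)
    ((integrable_levyIntegrand hd hα hα2 z).const_mul κ) (fun n => ?_) ?_
  · filter_upwards [ae_ne_zero hd] with y hy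
    have hy' : 0 < ‖y‖ := norm_pos_iff.2 hy
    have hcos : 0 ≤ 1 - Real.cos (inner ℝ z y) := by linarith [Real.cos_le_one (inner ℝ z y)]
    rw [Real.norm_of_nonneg (mul_nonneg hcos (jumpDensity_nonneg hκ (hδ n) y)), levyIntegrand,
      jumpDensity, mul_left_comm]
    gcongr κ * (_ * ?_)
    exact Real.rpow_le_rpow_of_nonpos hy' (by linarith [hδ n]) (neg_nonpos.2 (by positivity))
  · filter_upwards [ae_ne_zero hd] with y hy
    have hy' : 0 < ‖y‖ := norm_pos_iff.2 hy
    have h1 : Tendsto (fun n : ℕ => 1 / ((n : ℝ) + 1) + ‖y‖) atTop (𝓝 (0 + ‖y‖)) :=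
      tendsto_one_div_add_atTop_nhds_zero_nat.add_const _
    rw [zero_add] at h1
    have h2 := h1.rpow_const (p := -(d + α)) (Or.inl hy'.ne')
    have h3 := (h2.const_mul κ).const_mul (1 - Real.cos (inner ℝ z y))
    rw [levyIntegrand, mul_left_comm κ]
    exact h3

lemma abs_jumpExponent_le {J : Space d → ℝ} (hJ : Integrable J) (z : Space d) :
    |jumpExponent J z| ≤ 2 * ∫ y, ‖J y‖ := by
  rw [jumpExponent]
  refine (abs_sub _ _).trans ?_
  linarith [abs_cosTransform_le hJ 0, abs_cosTransform_le hJ z]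

lemma continuous_jumpExponent {J : Space d → ℝ} (hJ : Integrable J) :
    Continuous (jumpExponent J) :=
  continuous_const.sub (continuous_cosTransform hJ)

lemma integrable_exp_neg_rpow (hα : 0 < α) (hν : 0 < ν) :
    Integrable fun z : Space d => Real.exp (-(ν * ‖z‖ ^ α)) := by
  simpa using integrable_rpow_mul_exp_neg (d := d) hα le_rfl hν

lemma integrable_exp_neg_sub_jumpExponent (hα : 0 < α) (hν : 0 < ν) {J : Space d → ℝ}
    (hJ : Integrable J) :
    Integrable fun z : Space d => Real.exp (-(ν * ‖z‖ ^ α - jumpExponent J z)) := by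
  have e : ∀ z : Space d, Real.exp (-(ν * ‖z‖ ^ α - jumpExponent J z)) =
      Real.exp (jumpExponent J z) * Real.exp (-(ν * ‖z‖ ^ α)) := fun z => by
    rw [← Real.exp_add]; ring_nf
  simp_rw [e]
  refine (integrable_exp_neg_rpow hα hν).bdd_mul (c := Real.exp (2 * ∫ y, ‖J y‖))
    (Real.continuous_exp.comp (continuous_jumpExponent hJ)).aestronglyMeasurable
    (ae_of_all _ fun z => ?_)
  rw [Real.norm_of_nonneg (Real.exp_pos _).le]
  exact Real.exp_le_exp.2 ((le_abs_self _).trans (abs_jumpExponent_le hJ z))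

/-- The part of the stable law that is left after the jumps with density `jumpDensity α κ 1` have
been removed has a nonnegative density. -/
lemma isCosPositive_small_jumps (hd : 1 ≤ d) (hα : 0 < α) (hα2 : α < 2) (hν : 0 < ν) (hκ : 0 < κ)
    (hrep : ∀ z : Space d, ∫ y, κ * levyIntegrand α z y = ν * ‖z‖ ^ α) :
    IsCosPositive fun z : Space d =>
      Real.exp (-(ν * ‖z‖ ^ α - jumpExponent (jumpDensity α κ 1) z)) := by
  have hδ : ∀ n : ℕ, 0 < 1 / ((n : ℝ) + 1) := fun n => by positivity
  have hδ1 : ∀ n : ℕ, 1 / ((n : ℝ) + 1) ≤ 1 := fun n => by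
    rw [div_le_one (by positivity)]; linarith [(Nat.cast_nonneg n : (0 : ℝ) ≤ n)]
  have hJ1 : Integrable (jumpDensity α κ 1 : Space d → ℝ) := integrable_jumpDensity hα one_pos
  have hJ : ∀ n : ℕ, Integrable (jumpDensity α κ (1 / ((n : ℝ) + 1)) : Space d → ℝ) := fun n =>
    integrable_jumpDensity hα (hδ n)
  have hanti : ∀ (n : ℕ) (y : Space d), jumpDensity α κ 1 y ≤
      jumpDensity α κ (1 / ((n : ℝ) + 1)) y := fun n y => jumpDensity_anti hα hκ (hδ n) (hδ1 n) y
  have hmono : ∀ (n : ℕ) (z : Space d), jumpExponent (jumpDensity α κ 1) z ≤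
      jumpExponent (jumpDensity α κ (1 / ((n : ℝ) + 1))) z := fun n z =>
    jumpExponent_mono hJ1 (hJ n) (hanti n) z
  have hmono' : ∀ z : Space d, jumpExponent (jumpDensity α κ 1) z ≤ ν * ‖z‖ ^ α := fun z =>
    ge_of_tendsto' (tendsto_jumpExponent hd hα hα2 hκ hrep z) fun n => hmono n z
  have h_int := integrable_exp_neg_sub_jumpExponent (d := d) hα hν hJ1
  -- A compound Poisson symbol need not be integrable, so a Gaussian factor is inserted; it is
  -- removed at the end by `b → 0`.
  have hgauss : ∀ b : ℝ, 0 < b → IsCosPositive fun z : Space d => Real.exp (-(b * ‖z‖ ^ 2)) *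
      Real.exp (-(ν * ‖z‖ ^ α - jumpExponent (jumpDensity α κ 1) z)) := by
    intro b hb
    have hg := isCosPositive_gaussian (d := d) hb
    refine isCosPositive_of_tendsto
      (F := fun n z => Real.exp (-(b * ‖z‖ ^ 2)) *
        Real.exp (-(jumpExponent (jumpDensity α κ (1 / ((n : ℝ) + 1))) z -
          jumpExponent (jumpDensity α κ 1) z)))
      (bound := fun z => Real.exp (-(b * ‖z‖ ^ 2))) (fun n => ?_)
      (h_int.bdd_mul (c := 1) hg.integrable.aestronglyMeasurable (ae_of_all _ fun z => ?_))
      hg.integrable (fun n z => ?_) (fun z => ?_)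
    -- The jumps between the two truncation levels have the nonnegative density `K`. The `n`-th
    -- approximation is a Gaussian convolved with their compound Poisson law.
    · let K : Space d → ℝ := jumpDensity α κ (1 / ((n : ℝ) + 1)) - jumpDensity α κ 1
      have hK : Integrable K := (hJ n).sub hJ1
      have hKc : ∀ z, cosTransform K z = cosTransform (jumpDensity α κ (1 / ((n : ℝ) + 1))) z -
          cosTransform (jumpDensity α κ 1) z := by
        intro z
        rw [cosTransform, cosTransform, cosTransform, ← integral_sub (integrable_cos_mul (hJ n) z)
          (integrable_cos_mul hJ1 z)]
        congr with y
        simp [K, mul_sub]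
      have h := ((hg.exp_mul hK fun y => sub_nonneg.2 (hanti n y)).1).const_mul
        (Real.exp_pos (-cosTransform K 0)).le
      have e : (fun z : Space d => Real.exp (-(b * ‖z‖ ^ 2)) *
          Real.exp (-(jumpExponent (jumpDensity α κ (1 / ((n : ℝ) + 1))) z -
            jumpExponent (jumpDensity α κ 1) z))) = fun z =>
          Real.exp (-cosTransform K 0) *
            (Real.exp (cosTransform K z) * Real.exp (-(b * ‖z‖ ^ 2))) := by
        ext z
        rw [← Real.exp_add, ← Real.exp_add, ← Real.exp_add, hKc, hKc, jumpExponent, jumpExponent]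
        ring_nf
      rw [e]
      exact h
    · rw [Real.norm_of_nonneg (Real.exp_pos _).le, Real.exp_le_one_iff]
      exact neg_nonpos.2 (by positivity)
    · rw [Real.norm_of_nonneg (by positivity)]
      refine mul_le_of_le_one_right (Real.exp_pos _).le (Real.exp_le_one_iff.2 ?_)
      linarith [hmono n z]
    · refine Tendsto.const_mul _ ((Real.continuous_exp.tendsto _).comp ?_)
      exact ((tendsto_jumpExponent hd hα hα2 hκ hrep z).sub_const _).neg
  refine isCosPositive_of_tendsto (fun n : ℕ => hgauss (1 / ((n : ℝ) + 1)) (hδ n)) h_int h_int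
    (fun n z => ?_) (fun z => ?_)
  · rw [Real.norm_of_nonneg (by positivity)]
    refine mul_le_of_le_one_left (Real.exp_pos _).le (Real.exp_le_one_iff.2 ?_)
    exact neg_nonpos.2 (by positivity)
  · have h1 : Tendsto (fun n : ℕ => Real.exp (-(1 / ((n : ℝ) + 1) * ‖z‖ ^ 2))) atTop
        (𝓝 (Real.exp (-(0 * ‖z‖ ^ 2)))) :=
      (Real.continuous_exp.tendsto _).comp
        (tendsto_one_div_add_atTop_nhds_zero_nat.mul_const _).neg
    have h2 := h1.mul_const (Real.exp (-(ν * ‖z‖ ^ α - jumpExponent (jumpDensity α κ 1) z)))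
    simpa using h2

lemma heatKernel_eq_cosTransform (hα : 0 < α) (hν : 0 < ν) {t : ℝ} (ht : 0 < t) (x : Space d) :
    heatKernel α ν t x =
      ((2 * Real.pi) ^ d)⁻¹ * cosTransform (fun z => Real.exp (-(t * ν * ‖z‖ ^ α))) x := by
  rw [heatKernel]
  congr 1
  have h_int : Integrable fun z : Space d => Complex.exp (-Complex.I * (inner ℝ x z : ℝ)) *
      (Real.exp (-t * ν * ‖z‖ ^ α) : ℂ) := by
    simp_rw [← heatSymbol_eq_ofReal]
    exact (integrable_heatSymbol hα hν ht).bdd_mul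
      (Continuous.aestronglyMeasurable (by fun_prop))
      (ae_of_all _ fun z => (norm_exp_neg_I_mul _).le)
  have h := integral_re h_int
  simp only [RCLike.re_eq_complex_re] at h
  rw [← h, cosTransform]
  congr with z
  rw [Complex.re_mul_ofReal]
  congr 1
  · rw [Complex.exp_re]
    simp
  · ring_nf

/-- The lower bound of the stable heat kernel at time one. -/
lemma exists_le_heatKernel_one (hd : 1 ≤ d) (hα : 0 < α) (hα2 : α < 2) (hν : 0 < ν) :
    ∃ c : ℝ, 0 < c ∧ ∀ x : Space d, c * (1 + ‖x‖) ^ (-(d + α)) ≤ heatKernel α ν 1 x := by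
  obtain ⟨κ, hκ, hrep⟩ := exists_levy_representation hd hα hα2 hν
  let J : Space d → ℝ := jumpDensity α κ 1
  have hJ : Integrable J := integrable_jumpDensity hα one_pos
  have hJ0 : ∀ y, 0 ≤ J y := jumpDensity_nonneg hκ one_pos
  let φ : Space d → ℝ := fun z => Real.exp (-(ν * ‖z‖ ^ α - jumpExponent J z))
  have hφ : IsCosPositive φ := isCosPositive_small_jumps hd hα hα2 hν hκ hrep
  let Q := cosTransform φ
  have hQc : Continuous Q := continuous_cosTransform hφ.integrable
  have hQ0 : 0 < Q 0 := by
    have e : Q 0 = ∫ z, φ z := by simp [Q, cosTransform]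
    rw [e, integral_pos_iff_support_of_nonneg (fun z => (Real.exp_pos _).le) hφ.integrable]
    have : Function.support φ = Set.univ := by
      ext z; simp [φ, Real.exp_ne_zero]
    rw [this]
    exact Measure.measure_univ_pos.2 (NeZero.ne _)
  obtain ⟨η, hη, hball⟩ := Metric.eventually_nhds_iff.1
    (hQc.continuousAt.eventually (lt_mem_nhds (half_lt_self hQ0)))
  have hη1 : 0 < min η 1 := by positivity
  let v := (volume (Metric.ball (0 : Space d) (min η 1))).toReal
  have hv : 0 < v := ENNReal.toReal_pos (Metric.measure_ball_pos _ _ hη1).ne'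
    measure_ball_lt_top.ne
  -- The factors are the weight of the compound Poisson law, the lower bound of `J` near `x`, that
  -- of `Q` near `0`, and the volume of the ball.
  let c₀ : ℝ := Real.exp (-cosTransform J 0) * (1 / 2 * (κ * 2 ^ (-(d + α)) * (Q 0 / 2)) * v)
  refine ⟨((2 * Real.pi) ^ d)⁻¹ * c₀, by positivity, fun x => ?_⟩
  rw [heatKernel_eq_cosTransform hα hν one_pos, mul_assoc]
  gcongr
  -- The stable symbol factors into the compound Poisson part with jumps `J` and the remainder `φ`.
  have h1 : cosTransform (fun z : Space d => Real.exp (-(1 * ν * ‖z‖ ^ α))) x =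
      Real.exp (-cosTransform J 0) * cosTransform (fun z => Real.exp (cosTransform J z) * φ z) x := by
    change ∫ z, Real.cos (inner ℝ x z) * Real.exp (-(1 * ν * ‖z‖ ^ α)) =
      Real.exp (-cosTransform J 0) *
        ∫ z, Real.cos (inner ℝ x z) * (Real.exp (cosTransform J z) * φ z)
    rw [← integral_const_mul]
    congr with z
    rw [mul_left_comm]
    congr 1
    simp only [φ]
    rw [← Real.exp_add, ← Real.exp_add, jumpExponent]
    ring_nf
  rw [h1]
  simp only [c₀]
  rw [mul_assoc]
  gcongr
  refine le_trans ?_ ((hφ.exp_mul hJ hJ0).2 x)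
  rw [cosTransform_cosTransform_mul hφ.integrable hJ]
  change _ ≤ ∫ y, 1 / 2 * (J y * (Q (x + y) + Q (x - y)))
  have hnn : ∀ y, 0 ≤ 1 / 2 * (J y * (Q (x + y) + Q (x - y))) := fun y =>
    mul_nonneg (by norm_num) (mul_nonneg (hJ0 y) (add_nonneg (hφ.nonneg _) (hφ.nonneg _)))
  have h_int : Integrable fun y => 1 / 2 * (J y * (Q (x + y) + Q (x - y))) := by
    refine Integrable.const_mul ?_ _
    refine hJ.mul_bdd (c := (∫ z, ‖φ z‖) + ∫ z, ‖φ z‖)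
      (Continuous.aestronglyMeasurable (by fun_prop)) (ae_of_all _ fun y => ?_)
    exact (norm_add_le _ _).trans (add_le_add (abs_cosTransform_le hφ.integrable _)
      (abs_cosTransform_le hφ.integrable _))
  -- Only jumps `y` near `x` are kept, those after which the remainder need move by just `x - y`,
  -- where `Q ≥ Q 0 / 2`. There `1 + |y| ≤ 2 (1 + |x|)` bounds `J y` from below.
  refine le_trans ?_ (setIntegral_le_integral (s := Metric.ball x (min η 1)) h_int
    (ae_of_all _ hnn))
  have hvol : volume.real (Metric.ball x (min η 1)) = v := by
    simp only [v, Measure.real]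
    rw [Measure.addHaar_ball_center]
  have hconst := setIntegral_mono_on (μ := volume) (s := Metric.ball x (min η 1))
    (f := fun _ => 1 / 2 * (κ * 2 ^ (-(d + α)) * (1 + ‖x‖) ^ (-(d + α)) * (Q 0 / 2)))
    (integrableOn_const measure_ball_lt_top.ne) h_int.integrableOn
    Metric.isOpen_ball.measurableSet (fun y hy => by
      rw [mem_ball_iff_norm] at hy
      have hy1 : ‖y - x‖ < η := hy.trans_le (min_le_left _ _)
      have hy2 : ‖y - x‖ < 1 := hy.trans_le (min_le_right _ _)
      have hQy : Q 0 / 2 ≤ Q (x + y) + Q (x - y) := by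
        have h2 : Q 0 / 2 < Q (x - y) := hball (by
          rw [dist_zero_right, ← norm_neg, neg_sub]; exact hy1)
        have h3 : 0 ≤ Q (x + y) := hφ.nonneg _
        linarith
      have hJy : κ * 2 ^ (-(d + α)) * (1 + ‖x‖) ^ (-(d + α)) ≤ J y := by
        simp only [J, jumpDensity]
        rw [mul_assoc, ← Real.mul_rpow (by norm_num) (by positivity)]
        gcongr 1
        refine Real.rpow_le_rpow_of_nonpos (by positivity) ?_ (neg_nonpos.2 (by positivity))
        have h4 : ‖y‖ ≤ ‖y - x‖ + ‖x‖ := by simpa using norm_add_le (y - x) x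
        linarith [norm_nonneg x]
      gcongr
      exact hJ0 y)
  refine le_trans (le_of_eq ?_) hconst
  rw [setIntegral_const, hvol, smul_eq_mul]
  ring

lemma heatKernel_smul {r : ℝ} (hr : 0 < r) (t : ℝ) (x : Space d) :
    heatKernel α ν (r ^ α * t) (r • x) = (r ^ d)⁻¹ * heatKernel α ν t x := by
  have h := Measure.integral_comp_smul (volume : Measure (Space d))
    (fun z => Complex.exp (-Complex.I * (inner ℝ x z : ℝ)) *
      (Real.exp (-t * ν * ‖z‖ ^ α) : ℂ)) r
  have e : ∀ z : Space d, Complex.exp (-Complex.I * (inner ℝ x (r • z) : ℝ)) *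
      (Real.exp (-t * ν * ‖r • z‖ ^ α) : ℂ) =
      Complex.exp (-Complex.I * (inner ℝ (r • x) z : ℝ)) *
      (Real.exp (-(r ^ α * t) * ν * ‖z‖ ^ α) : ℂ) := by
    intro z
    rw [inner_smul_right, real_inner_smul_left, norm_smul, Real.norm_of_nonneg hr.le,
      Real.mul_rpow hr.le (norm_nonneg _)]
    congr 3
    ring
  simp_rw [e] at h
  rw [heatKernel, h, heatKernel]
  simp only [finrank_euclideanSpace, Fintype.card_fin]
  rw [abs_of_pos (by positivity), Complex.smul_re, smul_eq_mul]
  ring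

end LowerBound

/-! ### Rescaling -/

section Rescaling

variable {d : ℕ} {Ω : Type*} [MeasurableSpace Ω] {P : Measure Ω} [IsProbabilityMeasure P]
  {μ : Measure (Fin d → ℤ)} [IsProbabilityMeasure μ] {X : ℝ≥0 → Ω → (Fin d → ℤ)} {α ν a : ℝ}

lemma toSpace_injective : Function.Injective (toSpace : (Fin d → ℤ) → Space d) := by
  intro k l h
  ext i
  have := congrArg (fun v : Space d => v i) h
  simpa [toSpace] using this

/-- The error at lattice spacing `ε` in terms of the walk at lattice spacing one. -/
lemma exists_localError_eq (hX : IsRateOneWalk P μ X) {ε t : ℝ} (hε : 0 < ε) (ht : 0 < t) :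
    ∃ q : (Fin d → ℤ) → ℝ, (Summable fun l => ‖q l‖) ∧
      (∀ z, ∑' l, Complex.exp (Complex.I * (inner ℝ z (toSpace l) : ℝ)) * (q l : ℂ) =
        walkSymbol μ (t / ε ^ α) z) ∧
      ∀ k, localError P X α ν ε t (ε • toSpace k) =
        (ε ^ d)⁻¹ * |q k - heatKernel α ν (t / ε ^ α) (toSpace k)| := by
  set s : ℝ≥0 := (t / ε ^ α).toNNReal with hs
  have hsR : (s : ℝ) = t / ε ^ α := Real.coe_toNNReal _ (by positivity)
  have hm : Measurable (X s) := (charFn_map_walk hX s 0).1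
  have : IsProbabilityMeasure (P.map (X s)) := Measure.isProbabilityMeasure_map hm.aemeasurable
  refine ⟨fun l => (P.map (X s)).real {l}, ?_, fun z => ?_, fun k => ?_⟩
  · exact (summable_measureReal_singleton (P.map (X s))).norm
  · have h := (charFn_map_walk hX s z).2
    rw [charFn] at h
    rw [h, walkSymbol, ← hsR]
  · have h1 : {ω | ε • toSpace (X s ω) = ε • toSpace k} = X s ⁻¹' {k} := by
      ext ω
      change ε • toSpace (X s ω) = ε • toSpace k ↔ X s ω = k
      rw [smul_right_inj hε.ne', toSpace_injective.eq_iff]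
    have h2 : heatKernel α ν t (ε • toSpace k) =
        (ε ^ d)⁻¹ * heatKernel α ν (t / ε ^ α) (toSpace k) := by
      rw [← heatKernel_smul hε, mul_div_cancel₀ _ (by positivity)]
    simp only
    rw [localError, ← hs, h1, h2, map_measureReal_apply hm (measurableSet_singleton k), ← mul_sub,
      abs_mul, abs_of_pos (by positivity)]

/-- The uniform bound at `s = t / ε ^ α`; the prefactor `ε^(-d)` cancels the factor `ε^d` hidden in
`s^(-(d+a)/α)`. -/
lemma exists_localError_le (hX : IsRateOneWalk P μ X) (h1 : Assumption1 μ α ν a) (hα : 0 < α)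
    (hν : 0 < ν) (ha : 0 < a) :
    ∃ C : ℝ, 0 < C ∧ ∀ ε t : ℝ, 0 < ε → ε ^ α ≤ t → ∀ x ∈ lattice d ε,
      localError P X α ν ε t x ≤ C * (ε ^ a / t ^ ((d + a) / α)) := by
  obtain ⟨C, hC0, hC⟩ := h1.exists_uniform_bound hα hν ha
  refine ⟨C, hC0, ?_⟩
  rintro ε t hε hεt _ ⟨k, rfl⟩
  have hεα : 0 < ε ^ α := by positivity
  have ht : 0 < t := hεα.trans_le hεt
  obtain ⟨q, hq, hG, he⟩ := exists_localError_eq (α := α) (ν := ν) hX hε ht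
  simp only
  rw [he]
  have h := hC (t / ε ^ α) ((one_le_div hεα).2 hεt) q hq hG k
  have e : (t / ε ^ α) ^ (-((d + a) / α)) = ε ^ d * (ε ^ a / t ^ ((d + a) / α)) := by
    rw [Real.div_rpow ht.le hεα.le, Real.rpow_neg ht.le, ← Real.rpow_mul hε.le,
      show α * -((d + a) / α) = -(d + a) by field_simp, Real.rpow_neg hε.le, Real.rpow_add hε,
      Real.rpow_natCast]
    field_simp
  rw [e] at h
  calc _ ≤ (ε ^ d)⁻¹ * (C * (ε ^ d * (ε ^ a / t ^ ((d + a) / α)))) := by gcongr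
    _ = _ := by field_simp

lemma exists_localError_decay (hX : IsRateOneWalk P μ X) (h1 : Assumption1 μ α ν a)
    (h2 : Assumption2 μ α ν a) (hα : 0 < α) (hα2 : α ≤ 2) (hν : 0 < ν) (ha : 0 < a) (ha1 : a < 1) :
    ∃ C : ℝ, 0 < C ∧ ∀ ε t : ℝ, 0 < ε → ε ^ α ≤ t → ∀ x ∈ lattice d ε, x ≠ 0 →
      localError P X α ν ε t x ≤ C * (t * ε ^ a / ‖x‖ ^ (d + α + a)) := by
  obtain ⟨C, hC0, hC⟩ := exists_decay_bound h1 h2 hα hα2 hν ha ha1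
  refine ⟨C, hC0, ?_⟩
  rintro ε t hε hεt _ ⟨k, rfl⟩ hx
  have hεα : 0 < ε ^ α := by positivity
  have ht : 0 < t := hεα.trans_le hεt
  obtain ⟨q, hq, hG, he⟩ := exists_localError_eq (α := α) (ν := ν) hX hε ht
  simp only at hx ⊢
  have hk : k ≠ 0 := by
    rintro rfl
    apply hx
    have : (toSpace (0 : Fin d → ℤ) : Space d) = 0 := by ext i; simp [toSpace]
    rw [this, smul_zero]
  have hkn : 0 < ‖(toSpace k : Space d)‖ := norm_pos_iff.2 fun h => hx (by rw [h, smul_zero])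
  rw [he]
  have h := hC (t / ε ^ α) ((one_le_div hεα).2 hεt) q hq hG k hk
  rw [norm_smul, Real.norm_of_nonneg hε.le, Real.mul_rpow hε.le hkn.le]
  have e : ε ^ ((d : ℝ) + α + a) = ε ^ d * ε ^ α * ε ^ a := by
    rw [Real.rpow_add hε, Real.rpow_add hε, Real.rpow_natCast]
  rw [e]
  calc _ ≤ (ε ^ d)⁻¹ * (C * (t / ε ^ α / ‖(toSpace k : Space d)‖ ^ (d + α + a))) := by gcongr
    _ = _ := by field_simp

/-- Self-similarity reduces to time one with `u = |x| / t^(1/α)`; then `1 + u` is at most `2` or at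
most `2u`, according to the regime. -/
lemma exists_le_heatKernel (hd : 1 ≤ d) (hα : 0 < α) (hα2 : α < 2) (hν : 0 < ν) :
    ∃ c : ℝ, 0 < c ∧ ∀ t : ℝ, 0 < t → ∀ x : Space d,
      (‖x‖ ≤ t ^ (1 / α) → c * (t ^ (d / α))⁻¹ ≤ heatKernel α ν t x) ∧
      (t ^ (1 / α) ≤ ‖x‖ → c * (t / ‖x‖ ^ (d + α)) ≤ heatKernel α ν t x) := by
  obtain ⟨c, hc, hle⟩ := exists_le_heatKernel_one hd hα hα2 hν
  refine ⟨c * 2 ^ (-(d + α)), by positivity, fun t ht x => ?_⟩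
  have hr : 0 < t ^ (1 / α) := by positivity
  have e1 : (t ^ (1 / α)) ^ α = t := by
    rw [← Real.rpow_mul ht.le, one_div, inv_mul_cancel₀ hα.ne', Real.rpow_one]
  have e2 : (t ^ (1 / α)) ^ d = t ^ (d / α) := by
    rw [← Real.rpow_natCast, ← Real.rpow_mul ht.le, one_div_mul_eq_div]
  set r := t ^ (1 / α)
  have h1 : (r ^ d)⁻¹ * (c * (1 + r⁻¹ * ‖x‖) ^ (-(d + α))) ≤ heatKernel α ν t x := by
    have h := heatKernel_smul (α := α) (ν := ν) hr 1 (r⁻¹ • x)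
    rw [smul_smul, mul_inv_cancel₀ hr.ne', one_smul, e1, mul_one] at h
    rw [h]
    have h3 := hle (r⁻¹ • x)
    rw [norm_smul, Real.norm_of_nonneg (by positivity)] at h3
    gcongr
  have hneg : -(d + α) ≤ 0 := neg_nonpos.2 (by positivity)
  constructor
  · intro hx
    refine le_trans ?_ h1
    rw [e2]
    have h4 : (2 : ℝ) ^ (-(d + α)) ≤ (1 + r⁻¹ * ‖x‖) ^ (-(d + α)) := by
      refine Real.rpow_le_rpow_of_nonpos (by positivity) ?_ hneg
      have : r⁻¹ * ‖x‖ ≤ 1 := by rw [inv_mul_le_one₀ hr]; exact hx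
      linarith
    calc _ = (t ^ (d / α))⁻¹ * (c * 2 ^ (-(d + α))) := by ring
      _ ≤ _ := by gcongr
  · intro hx
    have hx0 : 0 < ‖x‖ := hr.trans_le hx
    refine le_trans ?_ h1
    have h4 : (2 * (r⁻¹ * ‖x‖)) ^ (-(d + α)) ≤ (1 + r⁻¹ * ‖x‖) ^ (-(d + α)) := by
      refine Real.rpow_le_rpow_of_nonpos (by positivity) ?_ hneg
      have : 1 ≤ r⁻¹ * ‖x‖ := by rw [inv_mul_eq_div, one_le_div hr]; exact hx
      linarith
    have h5 : (2 * (r⁻¹ * ‖x‖)) ^ (-(d + α)) = 2 ^ (-(d + α)) * (r ^ d * t / ‖x‖ ^ (d + α)) := by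
      rw [Real.mul_rpow (by norm_num) (by positivity), Real.mul_rpow (by positivity) hx0.le,
        Real.inv_rpow hr.le, Real.rpow_neg hr.le, inv_inv, Real.rpow_add hr, Real.rpow_natCast, e1,
        Real.rpow_neg hx0.le, div_eq_mul_inv]
    calc _ = (r ^ d)⁻¹ * (c * (2 ^ (-(d + α)) * (r ^ d * t / ‖x‖ ^ (d + α)))) := by field_simp
      _ ≤ _ := by rw [← h5]; gcongr

/-- Inside the ball of radius `t^(1/α)` the uniform bound matches the lower bound of the kernel.
Outside, the decay bound does, and its surplus factor `|x|^(-a)` is at most `t^(-a/α)`. -/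
lemma exists_localError_relative (hd : 1 ≤ d) (hX : IsRateOneWalk P μ X)
    (h1 : Assumption1 μ α ν a) (h2 : Assumption2 μ α ν a) (hα : 0 < α) (hα2 : α < 2) (hν : 0 < ν)
    (ha : 0 < a) (ha1 : a < 1) :
    ∃ C : ℝ, ∀ ε t : ℝ, 0 < ε → ε ^ α ≤ t → ∀ x ∈ lattice d ε,
      localError P X α ν ε t x ≤ C * (ε ^ a * heatKernel α ν t x / t ^ (a / α)) := by
  obtain ⟨C₁, hC₁0, hC₁⟩ := exists_localError_le (ν := ν) hX h1 hα hν ha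
  obtain ⟨C₂, hC₂0, hC₂⟩ := exists_localError_decay (ν := ν) hX h1 h2 hα hα2.le hν ha ha1
  obtain ⟨c, hc0, hc⟩ := exists_le_heatKernel (d := d) hd hα hα2 hν
  refine ⟨max C₁ C₂ / c, fun ε t hε hεt x hx => ?_⟩
  have ht : 0 < t := (by positivity : 0 < ε ^ α).trans_le hεt
  have hta : 0 < t ^ (a / α) := by positivity
  rcases le_total ‖x‖ (t ^ (1 / α)) with h | h
  · have hp := (hc t ht x).1 h
    have e : t ^ ((d + a) / α) = t ^ (d / α) * t ^ (a / α) := by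
      rw [← Real.rpow_add ht]; congr 1; ring
    calc _ ≤ _ := hC₁ ε t hε hεt x hx
      _ = C₁ / c * (ε ^ a * (c * (t ^ (d / α))⁻¹) / t ^ (a / α)) := by rw [e]; field_simp
      _ ≤ _ := by gcongr; exact le_max_left _ _
  · have hp := (hc t ht x).2 h
    have hx0 : 0 < ‖x‖ := (by positivity : 0 < t ^ (1 / α)).trans_le h
    have h3 : t ^ (a / α) ≤ ‖x‖ ^ a := by
      rw [show a / α = 1 / α * a by ring, Real.rpow_mul ht.le]
      gcongr
    calc _ ≤ _ := hC₂ ε t hε hεt x hx (norm_pos_iff.1 hx0)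
      _ = C₂ * (t * ε ^ a / (‖x‖ ^ (d + α) * ‖x‖ ^ a)) := by rw [Real.rpow_add hx0]
      _ ≤ C₂ * (t * ε ^ a / (‖x‖ ^ (d + α) * t ^ (a / α))) := by gcongr
      _ = C₂ / c * (ε ^ a * (c * (t / ‖x‖ ^ (d + α))) / t ^ (a / α)) := by field_simp
      _ ≤ _ := by gcongr; exact le_max_right _ _

end Rescaling

end LocalLimit

/-! ### The three error estimates. -/

theorem mainTheorem7 {d : ℕ} (hd : 1 ≤ d) {α ν a : ℝ} (hα : 0 < α) (hα2 : α ≤ 2) (hν : 0 < ν)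
    (ha : 0 < a) (ha1 : a < 1)
    (μ : MeasureTheory.Measure (Fin d → ℤ)) [MeasureTheory.IsProbabilityMeasure μ]
    {Ω : Type*} [MeasurableSpace Ω] (P : MeasureTheory.Measure Ω)
    [MeasureTheory.IsProbabilityMeasure P]
    (X : NNReal → Ω → (Fin d → ℤ)) (hX : LocalLimit.IsRateOneWalk P μ X)
    (h1 : LocalLimit.Assumption1 μ α ν a) (T : ℝ) (hT : 0 < T) :
    (∃ C : ℝ, ∀ ε t : ℝ, 0 < ε → ε ^ α ≤ t → t ≤ T → ∀ x ∈ LocalLimit.lattice d ε,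
      LocalLimit.localError P X α ν ε t x ≤ C * (ε ^ a / t ^ ((d + a) / α))) ∧
    (LocalLimit.Assumption2 μ α ν a →
      (∃ C : ℝ, ∀ ε t : ℝ, 0 < ε → ε ^ α ≤ t → t ≤ T → ∀ x ∈ LocalLimit.lattice d ε,
        t ^ (1 / α) ≤ ‖x‖ →
        LocalLimit.localError P X α ν ε t x ≤ C * (t * ε ^ a / ‖x‖ ^ (d + α + a))) ∧
      (α < 2 →
        ∃ C : ℝ, ∀ ε t : ℝ, 0 < ε → ε ^ α ≤ t → t ≤ T → ∀ x ∈ LocalLimit.lattice d ε,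
          LocalLimit.localError P X α ν ε t x ≤
            C * (ε ^ a * LocalLimit.heatKernel α ν t x / t ^ (a / α)))) := by
  refine ⟨?_, fun h2 => ⟨?_, fun hα2' => ?_⟩⟩
  · obtain ⟨C, -, hC⟩ := LocalLimit.exists_localError_le (ν := ν) hX h1 hα hν ha
    exact ⟨C, fun ε t hε hεt _ x hx => hC ε t hε hεt x hx⟩
  · obtain ⟨C, -, hC⟩ := LocalLimit.exists_localError_decay (ν := ν) hX h1 h2 hα hα2 hν ha ha1
    refine ⟨C, fun ε t hε hεt _ x hx hxt => hC ε t hε hεt x hx ?_⟩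
    have ht : 0 < t := (Real.rpow_pos_of_pos hε α).trans_le hεt
    exact norm_pos_iff.1 ((Real.rpow_pos_of_pos ht _).trans_le hxt)
  · obtain ⟨C, hC⟩ := LocalLimit.exists_localError_relative hd hX h1 h2 hα hα2' hν ha ha1
    exact ⟨C, fun ε t hε hεt _ x hx => hC ε t hε hεt x hx⟩
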